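/- For a simple labelled graph on $[n]=\{1,\dots,n\}$ put $Y_{ij}=Y_{ji}=1$ if $\{i,j\}$ is an edge and $Y_{ij}=Y_{ji}=-1$ if it is not ($i\ne j$), $Y_{ii}=0$, and $k_i=\sum_{j}Y_{ij}$. Let $\mathcal E=\{(i,j):1\le i<j\le n\}$. For $\theta>0$ and $\boldsymbol\beta\in\mathbb R^n$ the degree-corrected two-star ERGM is the probability mass function on $\{-1,1\}^{\mathcal E}$ $$\mathbb P_{n,\theta,\boldsymbol\beta}(Y)=\frac1{Z_n(\boldsymbol\beta,\theta)}\exp\Big\{\frac{\theta}{n-1}\sum_{i=1}^n\sum_{j<k}Y_{ij}Y_{ik}+\frac12\sum_{i=1}^n\beta_ik_i\Big\}.$$ For known $\theta$, $\beta_0$, consider testing $\mathcal H_0:\boldsymbol\beta=\beta_0\mathbf 1$ against $\mathcal H_1:\boldsymbol\beta\in\Xi(s,A)$, where $\Xi(s,A)=\{\beta_0\mathbf 1+\boldsymbol\mu:\ |\mathrm{supp}\,\boldsymbol\mu|\ge s,\ \mu_i\ge A\text{ for all }i\in\mathrm{supp}\,\boldsymbol\mu\}$. The risk of a test $T_n:\{-1,1\}^{\mathcal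 E}\to\{0,1\}$ is $$R(T_n)=\mathbb P_{n,\theta,\beta_0\mathbf 1}(T_n=1)+\sup_{\boldsymbol\beta\in\Xi(s,A)}\mathbb P_{n,\theta,\boldsymbol\beta}(T_n=0).$$ A sequence $(T_n)$ is asymptotically powerful if $R(T_n)\to0$ and asymptotically powerless if $R(T_n)\to1$. We say that all tests are asymptotically powerless if $\liminf_n R(T_n)\ge1$ for every sequence of tests; equivalently, every sequence with $\limsup_nR(T_n)\le 1$ (asymptotically no worse than the test that never rejects, whose risk is $1$) is asymptotically powerless. Write $D_e=Y_e-\mathbb E_{n,\theta,\beta_0\mathbf 1}(Y_e\mid Y_f:f\ne e)$ for $e\in\mathcal E$. The conditionally centered sum test with cut-off $L_n$ rejects ($T_n=1$) iff $\sum_{e\in\mathcal E}D_e>L_n$; the conditionally centered max test with cut-off $L_n$ rejects iff $\max_{i\in[n]}\sum_{e\ni i}D_e>L_n$. **Theorem 3.** Let either $0<\theta<1/2$ and $\beta_0=0$, or $\theta>0$ and $\beta_0\neq0$. There is a constant $C>0$, depending only on $\theta$ and $\beta_0$, such that for all $b\in(0,1)$ and $t<0$ the following hold for the above problem with $s=n^b$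 and $A=n^t$, as $n\to\infty$. (a) If $b\ge\frac12$ and $b+t<0$, then all tests are asymptotically powerless. (b) If $b\ge\frac12$ and $b+t>0$, then for every sequence $L_n$ with $L_n/n\to\infty$ and $L_n/(nsA)\to0$ the conditionally centered sum test with cut-off $L_n$ is asymptotically powerful. (c) If $b<\frac12$ and $t\le-\frac12$, then all tests are asymptotically powerless. (d) If $b<\frac12$ and $t>-\frac12$, then the conditionally centered max test with cut-off $L_n=C\sqrt{n\log n}$ is asymptotically powerful. -/

import Mathlib

open Filter Topology

noncomputable section

namespace TwoStar

/-- The edges `(i, j)`, `i < j`, of the complete graph on `n` labelled vertices. -/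
abbrev Edge (n : ℕ) : Type := {e : Fin n × Fin n // e.1 < e.2}

/-- Simple labelled graphs on `n` vertices, encoded as points of `{-1, 1}^(n choose 2)`:
`Y e = 1` if `e` is an edge of the graph and `Y e = -1` otherwise. -/
abbrev Config (n : ℕ) : Type := Edge n → ℤˣ

/-- The real number `±1` attached to a sign. -/
def spin (u : ℤˣ) : ℝ := ((u : ℤ) : ℝ)

/-- The symmetric `±1` adjacency matrix, with zero diagonal. -/
def adj {n : ℕ} (Y : Config n) (i j : Fin n) : ℝ :=
  if h : i < j then spin (Y ⟨(i, j), h⟩)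
  else if h : j < i then spin (Y ⟨(j, i), h⟩)
  else 0

/-- The "degree" `k_i = ∑_j Y_ij`. -/
def deg {n : ℕ} (Y : Config n) (i : Fin n) : ℝ := ∑ j, adj Y i j

/-- The two-star statistic `∑_i ∑_{j<k} Y_ij Y_ik`. -/
def twoStars {n : ℕ} (Y : Config n) : ℝ :=
  ∑ i, ∑ j, ∑ k, if j < k then adj Y i j * adj Y i k else 0

/-- The unnormalized weight of the degree corrected two-star model. -/
def weight {n : ℕ} (θ : ℝ) (β : Fin n → ℝ) (Y : Config n) : ℝ :=
  Real.exp (θ / ((n : ℝ) - 1) * twoStars Y + (1 / 2) * ∑ i, β i * deg Y i)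

/-- The normalizing constant. -/
def partitionFn {n : ℕ} (θ : ℝ) (β : Fin n → ℝ) : ℝ := ∑ Y : Config n, weight θ β Y

/-- The probability mass function of the degree corrected two-star model. -/
def pmf {n : ℕ} (θ : ℝ) (β : Fin n → ℝ) (Y : Config n) : ℝ :=
  weight θ β Y / partitionFn θ β

open Classical in
/-- The probability of an event under the degree corrected two-star model. -/
def prob {n : ℕ} (θ : ℝ) (β : Fin n → ℝ) (S : Set (Config n)) : ℝ :=
  ∑ Y : Config n, if Y ∈ S then pmf θ β Y else 0

/-- The conditional expectation of `Y_e` given `Y_f`, `f ≠ e`, as a function of the configuration: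
the average of `±1` over the two configurations that agree with `Y` off `e`, weighted by their
probabilities. -/
def condMean {n : ℕ} (θ : ℝ) (β : Fin n → ℝ) (e : Edge n) (Y : Config n) : ℝ :=
  (∑ u : ℤˣ, spin u * pmf θ β (Function.update Y e u)) /
    ∑ u : ℤˣ, pmf θ β (Function.update Y e u)

/-- The set of alternatives: `β = β₀ 1 + μ`, where `μ` has at least `s` nonzero entries and every
nonzero entry is at least `A`. -/
def alternatives (n : ℕ) (β₀ s A : ℝ) : Set (Fin n → ℝ) :=
  {β | ∃ μ : Fin n → ℝ, (∀ i, β i = β₀ + μ i) ∧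
    s ≤ ((Function.support μ).ncard : ℝ) ∧ ∀ i ∈ Function.support μ, A ≤ μ i}

/-- Non-randomized tests; the value `1` means that the null hypothesis is rejected. -/
abbrev Test (n : ℕ) : Type := Config n → Fin 2

/-- The risk: the type I error plus the supremum over the alternatives of the type II error. -/
def risk {n : ℕ} (θ β₀ s A : ℝ) (T : Test n) : ℝ :=
  prob θ (fun _ => β₀) {Y | T Y = 1} +
    ⨆ β : alternatives n β₀ s A, prob θ β.1 {Y | T Y = 0}

/-- The risk tends to `0`. -/
def AsympPowerful (θ β₀ : ℝ) (s A : ℕ → ℝ) (T : ∀ n, Test n) : Prop :=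
  Tendsto (fun n => risk θ β₀ (s n) (A n) (T n)) atTop (𝓝 0)

/-- The risk tends to `1`. -/
def AsympPowerless (θ β₀ : ℝ) (s A : ℕ → ℝ) (T : ∀ n, Test n) : Prop :=
  Tendsto (fun n => risk θ β₀ (s n) (A n) (T n)) atTop (𝓝 1)

/-- All tests are asymptotically powerless: no sequence of tests asymptotically improves on the
risk `1` of the test that never rejects, and every sequence that is asymptotically not worse than
that trivial test has risk tending to `1`. (Perverse tests, which reject under the null hypothesis
and accept under some alternatives, can have risk near `2`.) -/
def AllTestsAsympPowerless (θ β₀ : ℝ) (s A : ℕ → ℝ) : Prop :=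
  (∀ T : ∀ n, Test n, 1 ≤ liminf (fun n => risk θ β₀ (s n) (A n) (T n)) atTop) ∧
  ∀ T : ∀ n, Test n, limsup (fun n => risk θ β₀ (s n) (A n) (T n)) atTop ≤ 1 →
    AsympPowerless θ β₀ s A T

/-- The conditionally centered sum test with cut-off `L`. -/
def sumTest (n : ℕ) (θ β₀ L : ℝ) : Test n := fun Y =>
  if L < ∑ e : Edge n, (spin (Y e) - condMean θ (fun _ => β₀) e Y) then 1 else 0

/-- The conditionally centered degree of the vertex `i`: the sum over the pairs `e ∋ i`. -/
def centeredDeg {n : ℕ} (θ β₀ : ℝ) (i : Fin n) (Y : Config n) : ℝ :=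
  ∑ e : Edge n with e.1.1 = i ∨ e.1.2 = i, (spin (Y e) - condMean θ (fun _ => β₀) e Y)

/-- The conditionally centered maximum degree test with cut-off `L`. -/
def maxTest (n : ℕ) (θ β₀ L : ℝ) : Test n := fun Y =>
  if L < ⨆ i : Fin n, centeredDeg θ β₀ i Y then 1 else 0

/-- The parameter domain `(0, 1/2) × {0} ∪ {(θ, β₀) : θ > 0, β₀ ≠ 0}`. -/
def Theta1 : Set (ℝ × ℝ) :=
  Set.Ioo (0 : ℝ) (1 / 2) ×ˢ {0} ∪ {p | 0 < p.1 ∧ p.2 ≠ 0}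

end TwoStar

end

/-! The tests only involve sums of the conditionally centered signs `Y_e - E(Y_e ∣ rest)`, where
the conditional mean is `tanh` of a local field that changes by `O(1 / n)` when one edge is flipped.
Comparing a configuration with its flips bounds the moment generating function of such sums, so
they are sub-Gaussian with the variance of independent signs, up to a constant. Under an
alternative the null conditional mean at an edge meeting the support is too small by an amount of
order `A`, and this shift beats the fluctuations.

For the lower bounds, average the alternatives over signals carried by one random vertex in each of
`s` disjoint blocks. The second moment of the likelihood ratio is the average, over two independent
signals, of the exponential of a mixed second difference of the log-partition function, that is,
of an integrated covariance of weighted degrees. By the Griffiths–Hurst–Sherman inequality such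
covariances decrease when a nonnegative field increases, so the field can be taken constant. Then
exchangeability and positive association control all of them by the variance of the number of edges,
which is `O(n ^ 2)`: away from zero field by the concavity of the mean edge count in the field, and
at zero field by contraction, since `tanh` is `1`-Lipschitz and `2 * θ < 1`. -/

noncomputable section

namespace TwoStar

/-! ### Gibbs averages on finite sets -/

section Gibbs

variable {Ω : Type*} [Fintype Ω]

/-- The Gibbs average of the observable `X` for the weight `exp H`. Following the sign convention
of the model, the energy `H` enters with a plus sign. -/
def gibbsMean (H X : Ω → ℝ) : ℝ := (∑ ω, X ω * Real.exp (H ω)) / ∑ ω, Real.exp (H ω)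

/-- The covariance of `X` and `Y` under the Gibbs weight `exp H`. -/
def gibbsCov (H X Y : Ω → ℝ) : ℝ :=
  gibbsMean H (fun ω => X ω * Y ω) - gibbsMean H X * gibbsMean H Y

/-- The third joint cumulant of `X`, `Y` and `W` under the Gibbs weight `exp H`, as a central
moment. -/
def gibbsCum (H X Y W : Ω → ℝ) : ℝ :=
  gibbsMean H fun ω =>
    (X ω - gibbsMean H X) * (Y ω - gibbsMean H Y) * (W ω - gibbsMean H W)

theorem sum_exp_pos [Nonempty Ω] (H : Ω → ℝ) : 0 < ∑ ω, Real.exp (H ω) :=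
  Finset.sum_pos (fun _ _ => Real.exp_pos _) Finset.univ_nonempty

theorem gibbsMean_add (H X Y : Ω → ℝ) :
    gibbsMean H (fun ω => X ω + Y ω) = gibbsMean H X + gibbsMean H Y := by
  simp only [gibbsMean, add_mul, Finset.sum_add_distrib, add_div]

theorem gibbsMean_sub (H X Y : Ω → ℝ) :
    gibbsMean H (fun ω => X ω - Y ω) = gibbsMean H X - gibbsMean H Y := by
  simp only [gibbsMean, sub_mul, Finset.sum_sub_distrib, sub_div]

theorem gibbsMean_const_mul (H X : Ω → ℝ) (c : ℝ) :
    gibbsMean H (fun ω => c * X ω) = c * gibbsMean H X := by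
  simp only [gibbsMean, mul_assoc, ← Finset.mul_sum, mul_div_assoc]

theorem gibbsMean_const [Nonempty Ω] (H : Ω → ℝ) (c : ℝ) : gibbsMean H (fun _ => c) = c := by
  rw [gibbsMean, ← Finset.mul_sum, mul_div_assoc, div_self (sum_exp_pos H).ne', mul_one]

theorem gibbsMean_sum {ι : Type*} (s : Finset ι) (H : Ω → ℝ) (X : ι → Ω → ℝ) :
    gibbsMean H (fun ω => ∑ i ∈ s, X i ω) = ∑ i ∈ s, gibbsMean H (X i) := by
  simp only [gibbsMean, Finset.sum_mul, Finset.sum_div]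
  rw [Finset.sum_comm]

theorem gibbsMean_mono {H X Y : Ω → ℝ} (h : ∀ ω, X ω ≤ Y ω) : gibbsMean H X ≤ gibbsMean H Y := by
  unfold gibbsMean
  gcongr with ω
  exact h ω

theorem abs_gibbsMean_le (H X : Ω → ℝ) : |gibbsMean H X| ≤ gibbsMean H (fun ω => |X ω|) := by
  unfold gibbsMean
  rw [abs_div, abs_of_nonneg (Finset.sum_nonneg fun _ _ => (Real.exp_pos _).le :
    0 ≤ ∑ ω, Real.exp (H ω))]
  gcongr
  refine (Finset.abs_sum_le_sum_abs _ _).trans_eq ?_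
  simp only [abs_mul, Real.abs_exp]

theorem gibbsMean_comp_equiv {Ω' : Type*} [Fintype Ω'] (σ : Ω' ≃ Ω) (H X : Ω → ℝ) :
    gibbsMean (fun ω => H (σ ω)) (fun ω => X (σ ω)) = gibbsMean H X := by
  unfold gibbsMean
  rw [← Equiv.sum_comp σ (fun ω => X ω * Real.exp (H ω)),
    ← Equiv.sum_comp σ (fun ω => Real.exp (H ω))]

theorem gibbsCov_comp_equiv {Ω' : Type*} [Fintype Ω'] (σ : Ω' ≃ Ω) (H X Y : Ω → ℝ) :
    gibbsCov (fun ω => H (σ ω)) (fun ω => X (σ ω)) (fun ω => Y (σ ω)) = gibbsCov H X Y := by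
  unfold gibbsCov
  rw [← gibbsMean_comp_equiv σ H X, ← gibbsMean_comp_equiv σ H Y,
    ← gibbsMean_comp_equiv σ H (fun ω => X ω * Y ω)]

theorem gibbsCov_comm (H X Y : Ω → ℝ) : gibbsCov H X Y = gibbsCov H Y X := by
  simp only [gibbsCov, mul_comm]

theorem gibbsCov_add_left (H X X' Y : Ω → ℝ) :
    gibbsCov H (fun ω => X ω + X' ω) Y = gibbsCov H X Y + gibbsCov H X' Y := by
  simp only [gibbsCov, add_mul, gibbsMean_add]; ring

theorem gibbsCov_sub_left (H X X' Y : Ω → ℝ) :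
    gibbsCov H (fun ω => X ω - X' ω) Y = gibbsCov H X Y - gibbsCov H X' Y := by
  simp only [gibbsCov, sub_mul, gibbsMean_sub]; ring

theorem gibbsCov_const_mul_left (H X Y : Ω → ℝ) (c : ℝ) :
    gibbsCov H (fun ω => c * X ω) Y = c * gibbsCov H X Y := by
  simp only [gibbsCov, mul_assoc, gibbsMean_const_mul]; ring

theorem gibbsCov_const_mul_right (H X Y : Ω → ℝ) (c : ℝ) :
    gibbsCov H X (fun ω => c * Y ω) = c * gibbsCov H X Y := by
  rw [gibbsCov_comm, gibbsCov_const_mul_left, gibbsCov_comm]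

theorem gibbsCov_sum_left {ι : Type*} (s : Finset ι) (H : Ω → ℝ) (X : ι → Ω → ℝ) (Y : Ω → ℝ) :
    gibbsCov H (fun ω => ∑ i ∈ s, X i ω) Y = ∑ i ∈ s, gibbsCov H (X i) Y := by
  simp only [gibbsCov, Finset.sum_mul, gibbsMean_sum, Finset.sum_sub_distrib]

theorem gibbsCov_sum_right {ι : Type*} (s : Finset ι) (H : Ω → ℝ) (X : Ω → ℝ) (Y : ι → Ω → ℝ) :
    gibbsCov H X (fun ω => ∑ i ∈ s, Y i ω) = ∑ i ∈ s, gibbsCov H X (Y i) := by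
  rw [gibbsCov_comm, gibbsCov_sum_left]
  exact Finset.sum_congr rfl fun i _ => gibbsCov_comm _ _ _

theorem gibbsCov_add_const_left [Nonempty Ω] (H X Y : Ω → ℝ) (c : ℝ) :
    gibbsCov H (fun ω => X ω + c) Y = gibbsCov H X Y := by
  rw [gibbsCov_add_left, add_eq_left, gibbsCov, gibbsMean_const_mul, gibbsMean_const, sub_self]

theorem gibbsCov_add_const_right [Nonempty Ω] (H X Y : Ω → ℝ) (c : ℝ) :
    gibbsCov H X (fun ω => Y ω + c) = gibbsCov H X Y := by
  rw [gibbsCov_comm, gibbsCov_add_const_left, gibbsCov_comm]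

theorem gibbsCum_eq [Nonempty Ω] (H X Y W : Ω → ℝ) :
    gibbsCum H X Y W = gibbsMean H (fun ω => X ω * Y ω * W ω)
      - gibbsMean H (fun ω => X ω * Y ω) * gibbsMean H W
      - gibbsMean H (fun ω => X ω * W ω) * gibbsMean H Y
      - gibbsMean H (fun ω => Y ω * W ω) * gibbsMean H X
      + 2 * (gibbsMean H X * gibbsMean H Y * gibbsMean H W) := by
  unfold gibbsCum
  generalize hx : gibbsMean H X = x
  generalize hy : gibbsMean H Y = y
  generalize hw : gibbsMean H W = w
  have hexpand : (fun ω => (X ω - x) * (Y ω - y) * (W ω - w)) = fun ω => X ω * Y ω * W ω -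
      w * (X ω * Y ω) - y * (X ω * W ω) - x * (Y ω * W ω) + y * w * X ω + x * w * Y ω +
      x * y * W ω - x * y * w := by
    funext ω; ring
  simp only [hexpand, gibbsMean_add, gibbsMean_sub, gibbsMean_const_mul, gibbsMean_const, hx, hy,
    hw]
  ring

theorem hasDerivAt_sum_mul_exp (H G X : Ω → ℝ) (t : ℝ) :
    HasDerivAt (fun t : ℝ => ∑ ω, X ω * Real.exp (H ω + t * G ω))
      (∑ ω, X ω * G ω * Real.exp (H ω + t * G ω)) t := by
  refine (HasDerivAt.fun_sum (u := Finset.univ) fun ω _ =>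
    ((((hasDerivAt_id t).mul_const (G ω)).const_add (H ω)).exp.const_mul (X ω))).congr_deriv ?_
  refine Finset.sum_congr rfl fun ω _ => ?_
  simp only [id]
  ring

theorem hasDerivAt_sum_exp (H G : Ω → ℝ) (t : ℝ) :
    HasDerivAt (fun t : ℝ => ∑ ω, Real.exp (H ω + t * G ω))
      (∑ ω, G ω * Real.exp (H ω + t * G ω)) t := by
  simpa using hasDerivAt_sum_mul_exp H G (fun _ => 1) t

theorem hasDerivAt_log_sum_exp [Nonempty Ω] (H G : Ω → ℝ) (t : ℝ) :
    HasDerivAt (fun t : ℝ => Real.log (∑ ω, Real.exp (H ω + t * G ω)))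
      (gibbsMean (fun ω => H ω + t * G ω) G) t :=
  (hasDerivAt_sum_exp H G t).log (sum_exp_pos _).ne'

theorem hasDerivAt_gibbsMean [Nonempty Ω] (H G X : Ω → ℝ) (t : ℝ) :
    HasDerivAt (fun t : ℝ => gibbsMean (fun ω => H ω + t * G ω) X)
      (gibbsCov (fun ω => H ω + t * G ω) X G) t := by
  have hZ := (sum_exp_pos (fun ω => H ω + t * G ω)).ne'
  refine ((hasDerivAt_sum_mul_exp H G X t).div (hasDerivAt_sum_exp H G t) hZ).congr_deriv ?_
  unfold gibbsCov gibbsMean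
  generalize (∑ ω, X ω * G ω * Real.exp (H ω + t * G ω)) = a
  generalize (∑ ω, Real.exp (H ω + t * G ω)) = Z at hZ ⊢
  field_simp

theorem hasDerivAt_gibbsCov [Nonempty Ω] (H G X Y : Ω → ℝ) (t : ℝ) :
    HasDerivAt (fun t : ℝ => gibbsCov (fun ω => H ω + t * G ω) X Y)
      (gibbsCum (fun ω => H ω + t * G ω) X Y G) t := by
  refine ((hasDerivAt_gibbsMean H G (fun ω => X ω * Y ω) t).sub
    ((hasDerivAt_gibbsMean H G X t).mul (hasDerivAt_gibbsMean H G Y t))).congr_deriv ?_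
  rw [gibbsCum_eq]
  unfold gibbsCov
  ring

theorem gibbsMean_pi_prod {ι : Type*} [Fintype ι] [DecidableEq ι] (H : Ω → ℝ) (f : ι → Ω → ℝ) :
    gibbsMean (fun p : ι → Ω => ∑ a, H (p a)) (fun p => ∏ a, f a (p a)) =
      ∏ a, gibbsMean H (f a) := by
  simp only [gibbsMean, Real.exp_sum, ← Finset.prod_mul_distrib, Finset.prod_div_distrib]
  rw [← Fintype.prod_sum fun a ω => f a ω * Real.exp (H ω),
    ← Fintype.prod_sum fun (_ : ι) ω => Real.exp (H ω)]

section Lattice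

variable [DistribLattice Ω] [Nonempty Ω] {H F G : Ω → ℝ}

theorem gibbsCov_nonneg_of_monotone_of_nonneg
    (hH : ∀ x y, H x + H y ≤ H (x ⊓ y) + H (x ⊔ y)) (hF0 : 0 ≤ F) (hG0 : 0 ≤ G)
    (hF : Monotone F) (hG : Monotone G) : 0 ≤ gibbsCov H F G := by
  have hfkg := fkg (μ := fun x => Real.exp (H x)) (f := F) (g := G)
    (fun _ => (Real.exp_pos _).le) hF0 hG0 hF hG fun x y => by
      simp only [← Real.exp_add]
      exact Real.exp_le_exp.2 (hH x y)
  have hZ := sum_exp_pos H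
  simp only [mul_comm (Real.exp _)] at hfkg
  unfold gibbsCov gibbsMean
  rw [sub_nonneg, div_mul_div_comm, div_le_div_iff₀ (by positivity) hZ]
  nlinarith

theorem gibbsCov_nonneg_of_monotone (hH : ∀ x y, H x + H y ≤ H (x ⊓ y) + H (x ⊔ y))
    (hF : Monotone F) (hG : Monotone G) : 0 ≤ gibbsCov H F G := by
  obtain ⟨a, ha⟩ := (Set.finite_range F).bddBelow
  obtain ⟨b, hb⟩ := (Set.finite_range G).bddBelow
  rw [← gibbsCov_add_const_left H F G (-a), ← gibbsCov_add_const_right H _ G (-b)]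
  exact gibbsCov_nonneg_of_monotone_of_nonneg hH
    (fun x => by simpa using ha ⟨x, rfl⟩) (fun x => by simpa using hb ⟨x, rfl⟩)
    (hF.add_const _) (hG.add_const _)

end Lattice

end Gibbs

/-! ### Estimates by derivatives -/

theorem tanh_sub_tanh (x y : ℝ) :
    Real.tanh x - Real.tanh y = Real.sinh (x - y) / (Real.cosh x * Real.cosh y) := by
  rw [Real.tanh_eq_sinh_div_cosh, Real.tanh_eq_sinh_div_cosh,
    div_sub_div _ _ (Real.cosh_pos x).ne' (Real.cosh_pos y).ne', Real.sinh_sub]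

theorem tanh_monotone : Monotone Real.tanh := fun x y h => by
  rw [← sub_nonneg, tanh_sub_tanh]
  have := Real.sinh_nonneg_iff.2 (sub_nonneg.2 h)
  positivity

theorem hasDerivAt_tanh (x : ℝ) : HasDerivAt Real.tanh (1 / Real.cosh x ^ 2) x := by
  have hquot : Real.tanh = fun y => Real.sinh y / Real.cosh y :=
    funext Real.tanh_eq_sinh_div_cosh
  rw [hquot]
  refine ((Real.hasDerivAt_sinh x).fun_div (Real.hasDerivAt_cosh x)
    (Real.cosh_pos x).ne').congr_deriv ?_
  rw [← Real.cosh_sq_sub_sinh_sq x]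
  ring

theorem abs_tanh_sub_tanh_le (x y : ℝ) : |Real.tanh x - Real.tanh y| ≤ |x - y| := by
  have hderiv : ∀ z ∈ Set.univ, ‖1 / Real.cosh z ^ 2‖ ≤ 1 := fun z _ => by
    rw [Real.norm_of_nonneg (by positivity)]
    exact div_le_one_of_le₀ (one_le_pow₀ (Real.one_le_cosh z)) (by positivity)
  simpa using convex_univ.norm_image_sub_le_of_norm_hasDerivWithin_le
    (fun z _ => (hasDerivAt_tanh z).hasDerivWithinAt) hderiv (Set.mem_univ y) (Set.mem_univ x)

theorem le_tanh_add_sub_tanh {M h x y : ℝ} (hM : |h| ≤ M) (hx : 0 ≤ x) (hx1 : x ≤ 1)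
    (hxy : x ≤ y) : x / Real.cosh (M + 1) ^ 2 ≤ Real.tanh (h + y) - Real.tanh h := by
  have hM1 : |M + 1| = M + 1 := abs_of_nonneg (by linarith [abs_nonneg h])
  have hcosh_hx : Real.cosh (h + x) ≤ Real.cosh (M + 1) := by
    rw [Real.cosh_le_cosh, hM1]
    exact (abs_add_le _ _).trans (add_le_add hM (by rwa [abs_of_nonneg hx]))
  have hcosh_h : Real.cosh h ≤ Real.cosh (M + 1) := by
    rw [Real.cosh_le_cosh, hM1]
    linarith
  calc x / Real.cosh (M + 1) ^ 2
      ≤ Real.sinh (h + x - h) / (Real.cosh (h + x) * Real.cosh h) := by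
        rw [add_sub_cancel_left, sq]
        have := Real.sinh_nonneg_iff.2 hx
        gcongr
        exact Real.self_le_sinh_iff.2 hx
    _ = Real.tanh (h + x) - Real.tanh h := (tanh_sub_tanh _ _).symm
    _ ≤ Real.tanh (h + y) - Real.tanh h := by gcongr; exact tanh_monotone (by gcongr)

theorem sub_le_of_hasDerivAt_le {f f' : ℝ → ℝ} {C : ℝ} (hf : ∀ t, HasDerivAt f (f' t) t)
    (hC : ∀ t ∈ Set.Icc (0 : ℝ) 1, f' t ≤ C) : f 1 - f 0 ≤ C := by
  have hmvt := (convex_Icc (0 : ℝ) 1).image_sub_le_mul_sub_of_deriv_le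
    (fun t _ => (hf t).continuousAt.continuousWithinAt)
    (fun t _ => (hf t).differentiableAt.differentiableWithinAt)
    (fun t ht => (hf t).deriv.trans_le (hC t (interior_subset ht)))
    0 (Set.left_mem_Icc.2 zero_le_one) 1 (Set.right_mem_Icc.2 zero_le_one) zero_le_one
  simpa using hmvt

/-! ### The Griffiths–Hurst–Sherman inequality -/

theorem spin_one : spin 1 = 1 := by simp [spin]

theorem spin_neg (u : ℤˣ) : spin (-u) = -spin u := by simp [spin]

theorem spin_eq_one_or (u : ℤˣ) : spin u = 1 ∨ spin u = -1 := by
  rcases Int.units_eq_one_or u with rfl | rfl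
  · exact Or.inl spin_one
  · exact Or.inr (by rw [spin_neg, spin_one])

theorem spin_mul_self (u : ℤˣ) : spin u * spin u = 1 := by
  rcases spin_eq_one_or u with h | h <;> rw [h] <;> norm_num

theorem abs_spin (u : ℤˣ) : |spin u| = 1 := by
  rcases spin_eq_one_or u with h | h <;> rw [h] <;> norm_num

section GHS

/-- Twice the orthogonal matrix of the change of variables of Ellis and Monroe. -/
def rotMatrix : Matrix (Fin 4) (Fin 4) ℝ :=
  !![1, 1, 1, 1; 1, 1, -1, -1; 1, -1, 1, -1; -1, 1, 1, -1]

/-- The rotated values of an observable whose values at four replicas are `s a`. -/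
def rot (x : Fin 4) (s : Fin 4 → ℝ) : ℝ := (∑ a, rotMatrix x a * s a) / 2

theorem rot_eq (x : Fin 4) (s : Fin 4 → ℝ) :
    rot x s = ![s 0 + s 1 + s 2 + s 3, s 0 + s 1 - s 2 - s 3, s 0 - s 1 + s 2 - s 3,
      -s 0 + s 1 + s 2 - s 3] x / 2 := by
  fin_cases x <;> simp [rot, rotMatrix, Fin.sum_univ_four] <;> ring

theorem sum_rot_sq (s : Fin 4 → ℝ) : ∑ x, rot x s ^ 2 = ∑ a, s a ^ 2 := by
  simp only [Fin.sum_univ_four, rot_eq, Matrix.cons_val]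
  ring

theorem rot_sum {E : Type*} [Fintype E] (x : Fin 4) (c : E → ℝ) (s : Fin 4 → E → ℝ) :
    rot x (fun a => ∑ e, c e * s a e) = ∑ e, c e * rot x (fun a => s a e) := by
  simp only [rot, mul_div_assoc', ← Finset.sum_div, Finset.mul_sum]
  rw [Finset.sum_comm]
  simp only [mul_left_comm]

theorem prod_rot_spin_nonneg (q : Fin 4 → ℤˣ) : 0 ≤ ∏ x, rot x fun a => spin (q a) := by
  simp only [Fin.prod_univ_four, rot_eq, Matrix.cons_val]
  rcases spin_eq_one_or (q 0) with h0 | h0 <;> rcases spin_eq_one_or (q 1) with h1 | h1 <;>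
    rcases spin_eq_one_or (q 2) with h2 | h2 <;> rcases spin_eq_one_or (q 3) with h3 | h3 <;>
    rw [h0, h1, h2, h3] <;> norm_num

theorem prod_rot_spin_pow_nonneg {m : Fin 4 → ℕ} (hm : ∀ x, Even (m x + m 0)) (q : Fin 4 → ℤˣ) :
    0 ≤ ∏ x, (rot x fun a => spin (q a)) ^ m x := by
  rcases Nat.even_or_odd (m 0) with h0 | h0
  · exact Finset.prod_nonneg fun x _ => (((Nat.even_add.1 (hm x)).2 h0).pow_nonneg _)
  · have hodd : ∀ x, Odd (m x) := fun x => (Nat.even_add'.1 (hm x)).2 h0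
    have hsplit : ∀ x, m x = m x - 1 + 1 := fun x => (Nat.sub_add_cancel (hodd x).pos).symm
    rw [Finset.prod_congr rfl fun x _ => by rw [hsplit x, pow_succ], Finset.prod_mul_distrib]
    exact mul_nonneg
      (Finset.prod_nonneg fun x _ => (Nat.Odd.sub_odd (hodd x) odd_one).pow_nonneg _)
      (prod_rot_spin_nonneg q)

theorem sum_prod_rot_spin_pow_eq_zero {m : Fin 4 → ℕ} (g : (Fin 4 → ℤˣ) ≃ (Fin 4 → ℤˣ))
    (ε : Fin 4 → ℝ) (hg : ∀ x q, (rot x fun a => spin (g q a)) = ε x * rot x fun a => spin (q a))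
    (hε : ∏ x, ε x ^ m x = -1) : ∑ q : Fin 4 → ℤˣ, ∏ x, (rot x fun a => spin (q a)) ^ m x = 0 := by
  have hneg : ∑ q : Fin 4 → ℤˣ, ∏ x, (rot x fun a => spin (q a)) ^ m x =
      -∑ q : Fin 4 → ℤˣ, ∏ x, (rot x fun a => spin (q a)) ^ m x := by
    conv_lhs => rw [← Equiv.sum_comp g]
    simp only [hg, mul_pow, Finset.prod_mul_distrib, hε, neg_one_mul,
      Finset.sum_neg_distrib]
  linarith

/-- For `x ≠ 0`, the exchange of two pairs of replicas which fixes the rotated values numbered `0`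
and `x` and reverses the other two. -/
def replicaSwap (x : Fin 4) : Equiv.Perm (Fin 4) :=
  Function.Involutive.toPerm
    ((!![0, 1, 2, 3; 1, 0, 3, 2; 2, 3, 0, 1; 3, 2, 1, 0] : Matrix (Fin 4) (Fin 4) (Fin 4)) x)
    (by unfold Function.Involutive; decide +revert)

theorem rot_neg_replicaSwap {x : Fin 4} (hx : x ≠ 0) (y : Fin 4) (q : Fin 4 → ℤˣ) :
    (rot y fun a => spin (-q (replicaSwap x a))) =
      (if y = 0 ∨ y = x then -1 else 1) * rot y fun a => spin (q a) := by
  fin_cases x <;> first | exact absurd rfl hx | skip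
  all_goals fin_cases y <;> simp [replicaSwap, rot_eq, spin_neg] <;> ring

/-- Combining `replicaSwap` with a global spin flip shows that a monomial survives the summation
only if all of its exponents have the same parity. -/
theorem sum_prod_rot_spin_pow_nonneg (m : Fin 4 → ℕ) :
    0 ≤ ∑ q : Fin 4 → ℤˣ, ∏ x, (rot x fun a => spin (q a)) ^ m x := by
  by_cases hm : ∀ x, Even (m x + m 0)
  · exact Finset.sum_nonneg fun q _ => prod_rot_spin_pow_nonneg hm q
  push Not at hm
  obtain ⟨x, hx⟩ := hm
  have hx0 : x ≠ 0 := by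
    rintro rfl
    exact hx ⟨m 0, rfl⟩
  have hsign : ∏ y, (if y = 0 ∨ y = x then -1 else 1 : ℝ) ^ m y = -1 := by
    rw [Finset.prod_eq_mul 0 x hx0.symm (fun y _ hy => by simp [hy.1, hy.2]) (by simp) (by simp)]
    simpa [← pow_add, add_comm] using (Nat.not_even_iff_odd.1 hx).neg_one_pow
  exact (sum_prod_rot_spin_pow_eq_zero
    (((replicaSwap x).arrowCongr (Equiv.refl ℤˣ)).trans (Equiv.neg _)) _
    (fun y q => rot_neg_replicaSwap hx0 y q) hsign).ge

variable {E : Type*}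

/-- The functions of four replicas that are polynomials with nonnegative coefficients in the
rotated spins. -/
def posCone (E : Type*) : Subsemiring ((E → Fin 4 → ℤˣ) → ℝ) :=
  Subsemiring.closure ({G | ∃ c : ℝ, 0 ≤ c ∧ G = fun _ => c} ∪
    {G | ∃ (e : E) (x : Fin 4), G = fun q => rot x fun a => spin (q e a)})

theorem const_mem_posCone {c : ℝ} (hc : 0 ≤ c) : (fun _ => c) ∈ posCone E :=
  Subsemiring.subset_closure (Or.inl ⟨c, hc, rfl⟩)

theorem rot_mem_posCone (e : E) (x : Fin 4) :
    (fun q => rot x fun a => spin (q e a)) ∈ posCone E :=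
  Subsemiring.subset_closure (Or.inr ⟨e, x, rfl⟩)

variable [Fintype E]

theorem exists_eq_mul_prod_of_mem_closure {G : (E → Fin 4 → ℤˣ) → ℝ}
    (hG : G ∈ Submonoid.closure ({G | ∃ c : ℝ, 0 ≤ c ∧ G = fun _ => c} ∪
      {G | ∃ (e : E) (x : Fin 4), G = fun q => rot x fun a => spin (q e a)})) :
    ∃ (c : ℝ) (m : E → Fin 4 → ℕ), 0 ≤ c ∧
      G = fun q => c * ∏ e, ∏ x, (rot x fun a => spin (q e a)) ^ m e x := by
  classical
  induction hG using Submonoid.closure_induction with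
  | one => exact ⟨1, fun _ _ => 0, zero_le_one, by funext q; simp⟩
  | mul G G' _ _ h h' =>
    obtain ⟨c, m, hc, rfl⟩ := h
    obtain ⟨c', m', hc', rfl⟩ := h'
    refine ⟨c * c', m + m', mul_nonneg hc hc', ?_⟩
    funext q
    simp only [Pi.mul_apply, Pi.add_apply, pow_add, Finset.prod_mul_distrib]
    ring
  | mem G hG =>
    rcases hG with ⟨c, hc, rfl⟩ | ⟨e, x, rfl⟩
    · exact ⟨c, fun _ _ => 0, hc, by funext q; simp⟩
    · refine ⟨1, fun e' x' => if e' = e ∧ x' = x then 1 else 0, zero_le_one, ?_⟩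
      funext q
      rw [one_mul, Finset.prod_eq_single e, Finset.prod_eq_single x] <;> simp +contextual

theorem sum_nonneg_of_mem_posCone [DecidableEq E] {G : (E → Fin 4 → ℤˣ) → ℝ}
    (hG : G ∈ posCone E) : 0 ≤ ∑ q, G q := by
  rw [posCone, Subsemiring.mem_closure_iff] at hG
  induction hG using AddSubmonoid.closure_induction with
  | zero => simp
  | add G G' _ _ h h' =>
    simp only [Pi.add_apply, Finset.sum_add_distrib]
    exact add_nonneg h h'
  | mem G hG =>
    obtain ⟨c, m, hc, rfl⟩ := exists_eq_mul_prod_of_mem_closure hG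
    rw [← Finset.mul_sum, ← Fintype.prod_sum fun (e : E) (q : Fin 4 → ℤˣ) =>
      ∏ x, (rot x fun a => spin (q a)) ^ m e x]
    exact mul_nonneg hc (Finset.prod_nonneg fun e _ => sum_prod_rot_spin_pow_nonneg (m e))

theorem sum_mul_exp_nonneg_of_mem_posCone [DecidableEq E] {F G : (E → Fin 4 → ℤˣ) → ℝ}
    (hF : F ∈ posCone E) (hG : G ∈ posCone E) : 0 ≤ ∑ q, F q * Real.exp (G q) := by
  have hseries : HasSum (fun k : ℕ => ∑ q, F q * (G q ^ k / k.factorial))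
      (∑ q, F q * Real.exp (G q)) := by
    refine hasSum_sum fun q _ => ?_
    rw [Real.exp_eq_exp_ℝ]
    exact (NormedSpace.expSeries_div_hasSum_exp (G q)).mul_left _
  refine hseries.nonneg fun k => ?_
  have hterm := sum_nonneg_of_mem_posCone (mul_mem (mul_mem hF (pow_mem hG k))
    (const_mem_posCone (E := E) (by positivity : (0 : ℝ) ≤ 1 / (k.factorial : ℝ))))
  refine hterm.trans_eq (Finset.sum_congr rfl fun q _ => ?_)
  simp only [Pi.mul_apply, Pi.pow_apply]
  ring

/-- The linear form with coefficients `c` on spin configurations. -/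
def linForm (c : E → ℝ) (Y : E → ℤˣ) : ℝ := ∑ e, c e * spin (Y e)

/-- A ferromagnetic energy: a sum of squares of linear forms plus a linear form, whose coefficients
are nonnegative in all applications. -/
def ferroEnergy {ι : Type*} [Fintype ι] (c : ι → E → ℝ) (h : E → ℝ) (Y : E → ℤˣ) : ℝ :=
  ∑ i, linForm (c i) Y ^ 2 + linForm h Y

theorem rot_linForm_mem_posCone {c : E → ℝ} (hc : ∀ e, 0 ≤ c e) (x : Fin 4) :
    (fun q => rot x fun a => linForm c fun e => q e a) ∈ posCone E := by
  have hsum : (fun q : E → Fin 4 → ℤˣ => rot x fun a => linForm c fun e => q e a) =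
      ∑ e, (fun _ => c e) * fun q => rot x fun a => spin (q e a) := by
    funext q
    simp only [linForm, rot_sum, Finset.sum_apply, Pi.mul_apply]
  rw [hsum]
  exact sum_mem fun e _ => mul_mem (const_mem_posCone (hc e)) (rot_mem_posCone e x)

theorem sum_ferroEnergy_mem_posCone {ι : Type*} [Fintype ι] {c : ι → E → ℝ} {h : E → ℝ}
    (hc : ∀ i e, 0 ≤ c i e) (hh : ∀ e, 0 ≤ h e) :
    (fun q => ∑ a, ferroEnergy c h fun e => q e a) ∈ posCone E := by
  have hrot : (fun q : E → Fin 4 → ℤˣ => ∑ a, ferroEnergy c h fun e => q e a) =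
      ∑ i, ∑ x, (fun q => rot x fun a => linForm (c i) fun e => q e a) ^ 2 +
        (fun _ => 2) * fun q => rot 0 fun a => linForm h fun e => q e a := by
    funext q
    simp only [ferroEnergy, Finset.sum_add_distrib, Pi.add_apply, Finset.sum_apply, Pi.pow_apply,
      Pi.mul_apply, sum_rot_sq]
    rw [Finset.sum_comm]
    simp only [rot_eq, Matrix.cons_val, Fin.sum_univ_four]
    ring
  rw [hrot]
  exact add_mem
    (sum_mem fun i _ => sum_mem fun x _ => pow_mem (rot_linForm_mem_posCone (hc i) x) 2)
    (mul_mem (const_mem_posCone zero_le_two) (rot_linForm_mem_posCone hh 0))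

theorem gibbsMean_replicas_nonneg [DecidableEq E] {ι : Type*} [Fintype ι] {c : ι → E → ℝ}
    {h u v w : E → ℝ} (hc : ∀ i e, 0 ≤ c i e) (hh : ∀ e, 0 ≤ h e) (hu : ∀ e, 0 ≤ u e)
    (hv : ∀ e, 0 ≤ v e) (hw : ∀ e, 0 ≤ w e) :
    0 ≤ gibbsMean (fun p : Fin 4 → E → ℤˣ => ∑ a, ferroEnergy c h (p a)) fun p =>
      (rot 1 fun a => linForm u (p a)) * (rot 2 fun a => linForm v (p a)) *
        rot 3 fun a => linForm w (p a) := by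
  refine div_nonneg ?_ (sum_exp_pos _).le
  rw [← Equiv.sum_comp (Equiv.piComm fun (_ : E) (_ : Fin 4) => ℤˣ)]
  exact sum_mul_exp_nonneg_of_mem_posCone
    (mul_mem (mul_mem (rot_linForm_mem_posCone hu 1) (rot_linForm_mem_posCone hv 2))
      (rot_linForm_mem_posCone hw 3)) (sum_ferroEnergy_mem_posCone hc hh)

section Replicas

variable {Ω : Type*} [Fintype Ω] [Nonempty Ω]

theorem gibbsMean_mul_mul_of_centered {ι : Type*} [Fintype ι] [DecidableEq ι] {H X Y W : Ω → ℝ}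
    (hX : gibbsMean H X = 0) (hY : gibbsMean H Y = 0) (hW : gibbsMean H W = 0) (a b c : ι) :
    gibbsMean (fun p : ι → Ω => ∑ i, H (p i)) (fun p => X (p a) * Y (p b) * W (p c)) =
      if a = b ∧ b = c then gibbsMean H (fun ω => X ω * Y ω * W ω) else 0 := by
  have hprod : (fun p : ι → Ω => X (p a) * Y (p b) * W (p c)) = fun p => ∏ i,
      (if i = a then X (p i) else 1) * (if i = b then Y (p i) else 1) *
        (if i = c then W (p i) else 1) := by
    funext p
    simp only [Finset.prod_mul_distrib, Finset.prod_ite_eq', Finset.mem_univ, if_true]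
  rw [hprod, gibbsMean_pi_prod H fun i ω =>
    (if i = a then X ω else 1) * (if i = b then Y ω else 1) * (if i = c then W ω else 1)]
  split_ifs with h
  · obtain ⟨rfl, rfl⟩ := h
    rw [Finset.prod_eq_single a (fun i _ hi => by simp [hi, gibbsMean_const]) (by simp)]
    simp
  · have halone : a ≠ b ∧ a ≠ c ∨ b ≠ a ∧ b ≠ c ∨ c ≠ a ∧ c ≠ b := by grind
    rcases halone with ⟨h1, h2⟩ | ⟨h1, h2⟩ | ⟨h1, h2⟩
    · exact Finset.prod_eq_zero (Finset.mem_univ a) (by simpa [h1, h2] using hX)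
    · exact Finset.prod_eq_zero (Finset.mem_univ b) (by simpa [h1, h2] using hY)
    · exact Finset.prod_eq_zero (Finset.mem_univ c) (by simpa [h1, h2] using hW)

theorem rot_sub_const {x : Fin 4} (hx : x ≠ 0) (s : Fin 4 → ℝ) (t : ℝ) :
    (rot x fun a => s a - t) = rot x s := by
  fin_cases x <;> first | exact absurd rfl hx | skip
  all_goals simp only [rot_eq, Fin.mk_one, Fin.reduceFinMk, Matrix.cons_val]; ring

theorem gibbsMean_rot_mul_rot_mul_rot (H X Y W : Ω → ℝ) :
    gibbsMean (fun p : Fin 4 → Ω => ∑ a, H (p a)) (fun p =>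
      (rot 1 fun a => X (p a)) * (rot 2 fun a => Y (p a)) * rot 3 fun a => W (p a)) =
        -gibbsCum H X Y W / 2 := by
  have hcenter : ∀ X : Ω → ℝ, gibbsMean H (fun ω => X ω - gibbsMean H X) = 0 := fun X => by
    rw [gibbsMean_sub, gibbsMean_const, sub_self]
  have hmoment := gibbsMean_mul_mul_of_centered (ι := Fin 4) (hcenter X) (hcenter Y) (hcenter W)
  simp only [← rot_sub_const one_ne_zero (fun _ => X _) (gibbsMean H X),
    ← rot_sub_const (x := 2) (by decide) (fun _ => Y _) (gibbsMean H Y),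
    ← rot_sub_const (x := 3) (by decide) (fun _ => W _) (gibbsMean H W)]
  calc gibbsMean (fun p : Fin 4 → Ω => ∑ a, H (p a)) (fun p =>
        (rot 1 fun a => X (p a) - gibbsMean H X) * (rot 2 fun a => Y (p a) - gibbsMean H Y) *
          rot 3 fun a => W (p a) - gibbsMean H W)
      = ∑ c, ∑ b, ∑ a, rotMatrix 1 a * rotMatrix 2 b * rotMatrix 3 c / 8 *
          if a = b ∧ b = c then gibbsCum H X Y W else 0 := by
        simp only [gibbsCum, ← hmoment, ← gibbsMean_const_mul, ← gibbsMean_sum]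
        congr 1
        funext p
        simp only [rot, div_mul_div_comm, Finset.sum_mul, Finset.mul_sum,
          Finset.sum_div]
        refine Finset.sum_congr rfl fun c _ => Finset.sum_congr rfl fun b _ =>
          Finset.sum_congr rfl fun a _ => ?_
        ring
    _ = -gibbsCum H X Y W / 2 := by
        simp only [rotMatrix, Fin.isValue, Matrix.of_apply, Matrix.cons_val',
          Matrix.cons_val_fin_one, Matrix.cons_val_one, Matrix.cons_val_zero, Matrix.cons_val,
          mul_ite, mul_zero, Fin.sum_univ_four, one_mul, neg_mul, true_and, one_ne_zero,
          false_and, ↓reduceIte, add_zero, Fin.reduceEq, zero_ne_one, zero_add, neg_neg]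
        ring

end Replicas

theorem gibbsCum_ferroEnergy_nonpos [DecidableEq E] {ι : Type*} [Fintype ι] {c : ι → E → ℝ}
    {h u v w : E → ℝ} (hc : ∀ i e, 0 ≤ c i e) (hh : ∀ e, 0 ≤ h e) (hu : ∀ e, 0 ≤ u e)
    (hv : ∀ e, 0 ≤ v e) (hw : ∀ e, 0 ≤ w e) :
    gibbsCum (ferroEnergy c h) (linForm u) (linForm v) (linForm w) ≤ 0 := by
  have hnonneg := gibbsMean_replicas_nonneg hc hh hu hv hw
  rw [gibbsMean_rot_mul_rot_mul_rot] at hnonneg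
  linarith

end GHS

/-! ### Edges, degrees and the energy -/

section Energy

variable {n : ℕ}

theorem Edge.two_le (e : Edge n) : (2 : ℝ) ≤ n := by
  have : (e.1.1 : ℕ) < e.1.2 := e.2
  exact_mod_cast (by omega : 2 ≤ n)

theorem Edge.sub_one_pos (e : Edge n) : (0 : ℝ) < (n : ℝ) - 1 := by linarith [e.two_le]

/-- The incidence indicator of a vertex and an edge. -/
def incidence (i : Fin n) (e : Edge n) : ℝ := if e.1.1 = i ∨ e.1.2 = i then 1 else 0

theorem incidence_nonneg (i : Fin n) (e : Edge n) : 0 ≤ incidence i e := by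
  unfold incidence
  positivity

theorem incidence_mul_self (i : Fin n) (e : Edge n) :
    incidence i e * incidence i e = incidence i e := by
  unfold incidence
  split_ifs <;> norm_num

theorem incidence_eq_add (i : Fin n) (e : Edge n) :
    incidence i e = (if e.1.1 = i then 1 else 0) + if e.1.2 = i then 1 else 0 := by
  have hne : ¬(e.1.1 = i ∧ e.1.2 = i) := fun h => e.2.ne (h.1.trans h.2.symm)
  unfold incidence
  grind

theorem sum_incidence_vertex (e : Edge n) : ∑ i, incidence i e = 2 := by
  simp only [incidence_eq_add, Finset.sum_add_distrib, Finset.sum_ite_eq, Finset.mem_univ, if_true]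
  norm_num

/-- The symmetric extension of a function on edges to pairs of vertices, with zero diagonal. -/
def symmExt (f : Edge n → ℝ) (i j : Fin n) : ℝ :=
  if h : i < j then f ⟨(i, j), h⟩ else if h : j < i then f ⟨(j, i), h⟩ else 0

theorem sum_edge_ite (p : Fin n × Fin n) (f : Edge n → ℝ) :
    ∑ e : Edge n, (if e.1 = p then f e else 0) = if h : p.1 < p.2 then f ⟨p, h⟩ else 0 := by
  by_cases h : p.1 < p.2
  · rw [dif_pos h, Finset.sum_eq_single (⟨p, h⟩ : Edge n)]
    · simp
    · exact fun e _ he => if_neg fun hep => he (Subtype.ext hep)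
    · simp
  · rw [dif_neg h]
    exact Finset.sum_eq_zero fun e _ => if_neg fun hep => h <| by simpa only [hep] using e.2

theorem sum_incidence_mul (f : Edge n → ℝ) (i : Fin n) :
    ∑ e, incidence i e * f e = ∑ j, symmExt f i j := by
  have hedge : ∀ e : Edge n, incidence i e * f e =
      ∑ j, ((if e.1 = (i, j) then f e else 0) + if e.1 = (j, i) then f e else 0) := fun e => by
    simp [incidence_eq_add, Prod.ext_iff, Finset.sum_add_distrib, ite_and, add_mul]
  simp only [hedge]
  rw [Finset.sum_comm]
  refine Finset.sum_congr rfl fun j _ => ?_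
  rw [Finset.sum_add_distrib, sum_edge_ite, sum_edge_ite, symmExt]
  by_cases h : i < j
  · simp [h, h.not_gt]
  · simp [h]

theorem sum_incidence_edge (i : Fin n) : ∑ e, incidence i e = (n : ℝ) - 1 := by
  have hone : ∀ j, symmExt (fun _ : Edge n => 1) i j = 1 - if i = j then 1 else 0 := fun j => by
    unfold symmExt
    grind
  simpa [hone] using sum_incidence_mul (fun _ : Edge n => 1) i

theorem deg_eq_linForm (Y : Config n) (i : Fin n) : deg Y i = linForm (incidence i) Y :=
  (sum_incidence_mul (fun e => spin (Y e)) i).symm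

theorem abs_deg_le (Y : Config n) (i : Fin n) : |deg Y i| ≤ (n : ℝ) - 1 := by
  rw [deg_eq_linForm, linForm, ← sum_incidence_edge i]
  refine (Finset.abs_sum_le_sum_abs _ _).trans_eq ?_
  simp only [abs_mul, abs_spin, mul_one, abs_of_nonneg (incidence_nonneg _ _)]

theorem adj_sq (Y : Config n) (i j : Fin n) : adj Y i j ^ 2 = 1 - if i = j then 1 else 0 := by
  unfold adj
  rcases lt_trichotomy i j with h | h | h
  · simp [h, h.ne, sq, spin_mul_self]
  · simp [h]
  · simp [h, h.not_gt, h.ne', sq, spin_mul_self]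

theorem sum_sum_ite_lt_mul (a : Fin n → ℝ) :
    ∑ j, ∑ k, (if j < k then a j * a k else 0) = ((∑ j, a j) ^ 2 - ∑ j, a j ^ 2) / 2 := by
  have hsq : (∑ j, a j) ^ 2 = ∑ j, ∑ k, ((if j < k then a j * a k else 0) +
      (if k < j then a k * a j else 0) + if j = k then a j ^ 2 else 0) := by
    rw [sq, Finset.sum_mul_sum]
    refine Finset.sum_congr rfl fun j _ => Finset.sum_congr rfl fun k _ => ?_
    rcases lt_trichotomy j k with h | h | h
    · simp [h, h.ne, h.not_gt]
    · simp [h, sq]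
    · simp [h, h.ne', h.not_gt, mul_comm]
  simp only [Finset.sum_add_distrib, Finset.sum_ite_eq, Finset.mem_univ, if_true] at hsq
  rw [Finset.sum_comm (f := fun j k => if k < j then a k * a j else 0)] at hsq
  linarith

theorem twoStars_eq (Y : Config n) :
    twoStars Y = (∑ i, deg Y i ^ 2) / 2 - n * ((n : ℝ) - 1) / 2 := by
  simp only [twoStars, deg, sum_sum_ite_lt_mul, adj_sq, Finset.sum_sub_distrib, Finset.sum_const,
    Finset.card_univ, Fintype.card_fin, Finset.sum_ite_eq, Finset.mem_univ, if_true,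
    ← Finset.sum_div, nsmul_eq_mul, mul_one]
  ring

/-- The energy of the degree corrected two-star model, which differs from the exponent in `weight`
by a constant. -/
def energy (θ : ℝ) (β : Fin n → ℝ) (Y : Config n) : ℝ :=
  θ / (2 * ((n : ℝ) - 1)) * ∑ i, deg Y i ^ 2 + 1 / 2 * ∑ i, β i * deg Y i

theorem weight_eq (θ : ℝ) (β : Fin n → ℝ) (Y : Config n) :
    weight θ β Y = Real.exp (energy θ β Y) *
      Real.exp (-(θ / ((n : ℝ) - 1) * (n * ((n : ℝ) - 1) / 2))) := by
  rw [weight, ← Real.exp_add, twoStars_eq, energy, mul_comm 2 ((n : ℝ) - 1), ← div_div]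
  ring_nf

theorem pmf_eq (θ : ℝ) (β : Fin n → ℝ) (Y : Config n) :
    pmf θ β Y = Real.exp (energy θ β Y) / ∑ Y, Real.exp (energy θ β Y) := by
  simp only [pmf, partitionFn, weight_eq, ← Finset.sum_mul]
  exact mul_div_mul_right _ _ (Real.exp_pos _).ne'

theorem prob_eq_gibbsMean (θ : ℝ) (β : Fin n → ℝ) (S : Set (Config n)) :
    prob θ β S = gibbsMean (energy θ β) (S.indicator 1) := by
  rw [prob, gibbsMean, Finset.sum_div]
  refine Finset.sum_congr rfl fun Y _ => ?_
  by_cases h : Y ∈ S <;> simp [h, pmf_eq]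

theorem prob_le_gibbsMean (θ : ℝ) (β : Fin n → ℝ) {S : Set (Config n)} {G : Config n → ℝ}
    (h0 : ∀ Y, 0 ≤ G Y) (h1 : ∀ Y ∈ S, 1 ≤ G Y) : prob θ β S ≤ gibbsMean (energy θ β) G := by
  rw [prob_eq_gibbsMean]
  exact gibbsMean_mono fun Y => Set.indicator_le' h1 (fun Y _ => h0 Y) Y

theorem prob_nonneg (θ : ℝ) (β : Fin n → ℝ) (S : Set (Config n)) : 0 ≤ prob θ β S := by
  rw [prob_eq_gibbsMean, ← gibbsMean_const (energy θ β) 0]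
  exact gibbsMean_mono (Set.indicator_nonneg fun _ _ => zero_le_one)

theorem prob_le_one (θ : ℝ) (β : Fin n → ℝ) (S : Set (Config n)) : prob θ β S ≤ 1 :=
  (prob_le_gibbsMean θ β (fun _ => zero_le_one) fun _ _ => le_rfl).trans_eq (gibbsMean_const _ 1)

theorem prob_mono (θ : ℝ) (β : Fin n → ℝ) {S T : Set (Config n)} (h : S ⊆ T) :
    prob θ β S ≤ prob θ β T := by
  rw [prob_eq_gibbsMean θ β S, prob_eq_gibbsMean θ β T]
  exact gibbsMean_mono (Set.indicator_le_indicator_of_subset h fun _ => zero_le_one)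

end Energy

/-! ### Conditional means -/

section Flip

variable {n : ℕ}

theorem deg_update (Y : Config n) (e : Edge n) (u : ℤˣ) (i : Fin n) :
    deg (Function.update Y e u) i = deg Y i + incidence i e * (spin u - spin (Y e)) := by
  simp only [deg_eq_linForm, linForm]
  rw [← Finset.add_sum_erase _ _ (Finset.mem_univ e),
    ← Finset.add_sum_erase (a := e) _ (fun f => incidence i f * spin (Y f)) (Finset.mem_univ e),
    Finset.sum_congr rfl fun f hf => by rw [Function.update_of_ne (Finset.ne_of_mem_erase hf)]]
  rw [Function.update_self]
  ring

/-- The local field acting on the edge `e`: half the derivative of the energy in the spin at `e`,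
which does not depend on that spin. -/
def localField (θ : ℝ) (β : Fin n → ℝ) (e : Edge n) (Y : Config n) : ℝ :=
  ∑ i, incidence i e * (θ / ((n : ℝ) - 1) * (deg Y i - spin (Y e)) + β i / 2)

theorem localField_update (θ : ℝ) (β : Fin n → ℝ) (e : Edge n) (Y : Config n) (u : ℤˣ) :
    localField θ β e (Function.update Y e u) = localField θ β e Y := by
  refine Finset.sum_congr rfl fun i _ => ?_
  rw [deg_update, Function.update_self]
  linear_combination (θ / ((n : ℝ) - 1) * (spin u - spin (Y e))) * incidence_mul_self i e

theorem energy_update (θ : ℝ) (β : Fin n → ℝ) (e : Edge n) (Y : Config n) (u : ℤˣ) :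
    energy θ β (Function.update Y e u) =
      energy θ β Y + (spin u - spin (Y e)) * localField θ β e Y := by
  unfold energy localField
  simp only [deg_update, Finset.mul_sum, ← Finset.sum_add_distrib]
  refine Finset.sum_congr rfl fun i _ => ?_
  rw [mul_comm 2 ((n : ℝ) - 1), ← div_div]
  generalize θ / ((n : ℝ) - 1) = κ
  linear_combination κ / 2 * (spin u - spin (Y e)) ^ 2 * incidence_mul_self i e +
    κ / 2 * incidence i e * (spin_mul_self u - spin_mul_self (Y e))

theorem condMean_eq (θ : ℝ) (β : Fin n → ℝ) (e : Edge n) (Y : Config n) :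
    condMean θ β e Y = Real.tanh (localField θ β e Y) := by
  have := sum_exp_pos (energy (n := n) θ β)
  have hpmf : ∀ u, pmf θ β (Function.update Y e u) =
      Real.exp (energy θ β Y - spin (Y e) * localField θ β e Y) / (∑ Y, Real.exp (energy θ β Y)) *
        Real.exp (spin u * localField θ β e Y) := fun u => by
    rw [pmf_eq, energy_update, div_mul_eq_mul_div, ← Real.exp_add]
    ring_nf
  simp only [condMean, hpmf, UnitsInt.univ, Finset.sum_pair (by decide : (1 : ℤˣ) ≠ -1), spin_neg,
    spin_one, mul_left_comm (spin _), neg_mul, one_mul, ← mul_add]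
  rw [mul_div_mul_left _ _ (by positivity), Real.tanh_eq_sinh_div_cosh, Real.sinh_eq, Real.cosh_eq,
    div_div_div_cancel_right₀ two_ne_zero, sub_eq_add_neg]

/-- The conditionally centered sign of the edge `e`. -/
def centeredSpin (θ : ℝ) (β : Fin n → ℝ) (e : Edge n) (Y : Config n) : ℝ :=
  spin (Y e) - Real.tanh (localField θ β e Y)

theorem abs_centeredSpin_le (θ : ℝ) (β : Fin n → ℝ) (e : Edge n) (Y : Config n) :
    |centeredSpin θ β e Y| ≤ 2 := by
  refine (abs_sub _ _).trans ?_
  rw [abs_spin]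
  linarith [Real.abs_tanh_lt_one (localField θ β e Y)]

theorem spin_sub_tanh (u : ℤˣ) (x : ℝ) :
    spin u - Real.tanh x = spin u * (Real.exp (-(spin u * x)) / Real.cosh x) := by
  have hcosh := (Real.cosh_pos x).ne'
  rcases spin_eq_one_or u with h | h <;> rw [h, Real.tanh_eq_sinh_div_cosh] <;> field_simp
  · rw [Real.cosh_sub_sinh]
  · rw [← Real.cosh_add_sinh]
    ring

/-- The configuration with the sign of the edge `e` reversed. -/
def flip (e : Edge n) (Y : Config n) : Config n := Function.update Y e (-Y e)

theorem flip_involutive (e : Edge n) : Function.Involutive (flip e) := fun Y => by simp [flip]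

theorem centeredSpin_flip_self (θ : ℝ) (β : Fin n → ℝ) (e : Edge n) (Y : Config n) :
    centeredSpin θ β e (flip e Y) = centeredSpin θ β e Y - 2 * spin (Y e) := by
  rw [centeredSpin, centeredSpin, flip, localField_update, Function.update_self, spin_neg]
  ring

theorem centeredSpin_mul_exp_energy_flip (θ : ℝ) (β : Fin n → ℝ) (e : Edge n) (Y : Config n) :
    centeredSpin θ β e (flip e Y) * Real.exp (energy θ β (flip e Y)) =
      -(centeredSpin θ β e Y * Real.exp (energy θ β Y)) := by
  simp only [centeredSpin, flip, localField_update, energy_update, Function.update_self]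
  rw [spin_sub_tanh, spin_sub_tanh, spin_neg, mul_assoc, mul_assoc, div_mul_eq_mul_div,
    div_mul_eq_mul_div, ← Real.exp_add, ← Real.exp_add]
  ring_nf

theorem gibbsMean_centeredSpin_mul_eq_zero (θ : ℝ) (β : Fin n → ℝ) (e : Edge n)
    {G : Config n → ℝ} (hG : ∀ Y, G (flip e Y) = G Y) :
    gibbsMean (energy θ β) (fun Y => centeredSpin θ β e Y * G Y) = 0 := by
  rw [gibbsMean, div_eq_zero_iff]
  left
  refine self_eq_neg.1 ?_
  conv_lhs => rw [← Equiv.sum_comp (flip_involutive e).toPerm]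
  rw [← Finset.sum_neg_distrib]
  refine Finset.sum_congr rfl fun Y _ => ?_
  rw [Function.Involutive.coe_toPerm, hG]
  linear_combination G Y * centeredSpin_mul_exp_energy_flip θ β e Y

theorem gibbsMean_centeredSpin_mul (θ : ℝ) (β : Fin n → ℝ) (e : Edge n) (G : Config n → ℝ) :
    gibbsMean (energy θ β) (fun Y => centeredSpin θ β e Y * G Y) =
      gibbsMean (energy θ β) (fun Y => centeredSpin θ β e Y * ((G Y - G (flip e Y)) / 2)) := by
  rw [← sub_eq_zero, ← gibbsMean_sub, ← gibbsMean_centeredSpin_mul_eq_zero θ β e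
    (G := fun Y => (G Y + G (flip e Y)) / 2) fun Y => by rw [flip_involutive, add_comm]]
  congr 1
  funext Y
  ring

theorem localField_flip {e f : Edge n} (h : f ≠ e) (θ : ℝ) (β : Fin n → ℝ) (Y : Config n) :
    localField θ β f (flip e Y) = localField θ β f Y -
      spin (Y e) * (2 * θ / ((n : ℝ) - 1) * ∑ i, incidence i e * incidence i f) := by
  simp only [localField, Finset.mul_sum, ← Finset.sum_sub_distrib]
  refine Finset.sum_congr rfl fun i _ => ?_
  rw [flip, deg_update, Function.update_of_ne h, spin_neg]
  ring

theorem abs_centeredSpin_sub_flip_le {θ : ℝ} (hθ : 0 ≤ θ) (β : Fin n → ℝ) (e f : Edge n)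
    (Y : Config n) : |centeredSpin θ β f Y - centeredSpin θ β f (flip e Y)| ≤
      (if f = e then 2 else 0) + 2 * θ / ((n : ℝ) - 1) * ∑ i, incidence i e * incidence i f := by
  have hn := e.sub_one_pos
  have hs : 0 ≤ ∑ i, incidence i e * incidence i f :=
    Finset.sum_nonneg fun i _ => mul_nonneg (incidence_nonneg _ _) (incidence_nonneg _ _)
  split_ifs with h
  · subst h
    rw [centeredSpin_flip_self, sub_sub_cancel, abs_mul, abs_spin, abs_two, mul_one]
    exact le_add_of_nonneg_right (by positivity)
  · rw [centeredSpin, centeredSpin, localField_flip h, flip, Function.update_of_ne h,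
      sub_sub_sub_cancel_left, zero_add]
    refine (abs_tanh_sub_tanh_le _ _).trans_eq ?_
    rw [sub_sub_cancel_left, abs_neg, abs_mul, abs_spin, one_mul, abs_of_nonneg (by positivity)]

theorem abs_sum_centeredSpin_sub_flip_le {θ : ℝ} (hθ : 0 ≤ θ) (β : Fin n → ℝ)
    (B : Finset (Edge n)) (e : Edge n) (Y : Config n) :
    |∑ f ∈ B, centeredSpin θ β f Y - ∑ f ∈ B, centeredSpin θ β f (flip e Y)| ≤ 2 + 4 * θ := by
  have hn := e.sub_one_pos
  rw [← Finset.sum_sub_distrib]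
  calc |∑ f ∈ B, (centeredSpin θ β f Y - centeredSpin θ β f (flip e Y))|
      ≤ ∑ f ∈ B, |centeredSpin θ β f Y - centeredSpin θ β f (flip e Y)| :=
        Finset.abs_sum_le_sum_abs _ _
    _ ≤ ∑ f, |centeredSpin θ β f Y - centeredSpin θ β f (flip e Y)| :=
        Finset.sum_le_sum_of_subset_of_nonneg (Finset.subset_univ B) fun _ _ _ => abs_nonneg _
    _ ≤ ∑ f, ((if f = e then 2 else 0) +
          2 * θ / ((n : ℝ) - 1) * ∑ i, incidence i e * incidence i f) :=
        Finset.sum_le_sum fun f _ => abs_centeredSpin_sub_flip_le hθ β e f Y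
    _ = 2 + 4 * θ := by
        rw [Finset.sum_add_distrib, ← Finset.mul_sum, Finset.sum_comm]
        simp only [← Finset.mul_sum, sum_incidence_edge, ← Finset.sum_mul, sum_incidence_vertex,
          Finset.sum_ite_eq', Finset.mem_univ, if_true]
        field_simp
        ring

end Flip

/-! ### Concentration of conditionally centered sums -/

section Tilting

variable {Ω : Type*} [Fintype Ω]

theorem gibbsMean_mul_exp [Nonempty Ω] (H G X : Ω → ℝ) :
    gibbsMean H (fun ω => X ω * Real.exp (G ω)) =
      gibbsMean (fun ω => H ω + G ω) X * gibbsMean H (fun ω => Real.exp (G ω)) := by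
  have := (sum_exp_pos fun ω => H ω + G ω).ne'
  simp only [gibbsMean, mul_assoc, mul_comm (Real.exp (G _)), ← Real.exp_add]
  field_simp

-- Herbst's argument: integrate the derivative of the cumulant generating function.
theorem gibbsMean_exp_le_of_gibbsMean_tilt_le [Nonempty Ω] {H F : Ω → ℝ} {M l : ℝ} (hl : 0 ≤ l)
    (h : ∀ u ∈ Set.Icc 0 l, gibbsMean (fun ω => H ω + u * F ω) F ≤ M * u) :
    gibbsMean H (fun ω => Real.exp (l * F ω)) ≤ Real.exp (M * l ^ 2 / 2) := by
  have hderiv : ∀ u : ℝ, HasDerivAt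
      (fun u : ℝ => Real.log (∑ ω, Real.exp (H ω + u * F ω)) - M * u ^ 2 / 2)
      (gibbsMean (fun ω => H ω + u * F ω) F - M * u) u := fun u => by
    refine (hasDerivAt_log_sum_exp H F u).sub
      ((((hasDerivAt_pow 2 u).const_mul M).div_const 2).congr_deriv ?_)
    norm_num
    ring
  have hanti := antitoneOn_of_deriv_nonpos (convex_Icc 0 l)
    (fun u _ => (hderiv u).continuousAt.continuousWithinAt)
    (fun u _ => (hderiv u).differentiableAt.differentiableWithinAt) fun u hu => by
      rw [(hderiv u).deriv]
      exact sub_nonpos.2 (h u (interior_subset hu))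
  have hlog := hanti (Set.left_mem_Icc.2 hl) (Set.right_mem_Icc.2 hl) hl
  have hZ := sum_exp_pos H
  simp only [zero_mul, add_zero] at hlog
  rw [gibbsMean, div_le_iff₀ hZ, ← Real.exp_log hZ, ← Real.exp_add, ← Real.log_le_iff_le_exp]
  · simp only [← Real.exp_add, add_comm (l * F _)]
    linarith
  · simpa only [← Real.exp_add] using sum_exp_pos _

end Tilting

theorem abs_exp_sub_one_le_mul_exp (x : ℝ) : |Real.exp x - 1| ≤ |x| * Real.exp |x| := by
  have h : ‖Complex.exp x - 1‖ ≤ ‖(x : ℂ)‖ * Real.exp ‖(x : ℂ)‖ := by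
    simpa only [Finset.sum_range_one, pow_zero, Nat.factorial_zero, Nat.cast_one, div_one, pow_one]
      using Complex.norm_exp_sub_sum_le_norm_mul_exp x 1
  exact_mod_cast h

section Concentration

variable {n : ℕ}

theorem gibbsMean_sq_sum_centeredSpin_le {θ : ℝ} (hθ : 0 ≤ θ) (β : Fin n → ℝ)
    (B : Finset (Edge n)) :
    gibbsMean (energy θ β) (fun Y => (∑ f ∈ B, centeredSpin θ β f Y) ^ 2) ≤
      B.card * (2 + 4 * θ) := by
  simp only [sq, Finset.sum_mul _ _ (∑ f ∈ B, centeredSpin θ β f _)]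
  rw [gibbsMean_sum, ← nsmul_eq_mul]
  refine Finset.sum_le_card_nsmul _ _ _ fun e _ => ?_
  rw [gibbsMean_centeredSpin_mul]
  refine (gibbsMean_mono fun Y => (le_abs_self _).trans ?_).trans_eq
    (gibbsMean_const _ (2 + 4 * θ))
  rw [abs_mul, abs_div, abs_two]
  calc _ ≤ 2 * ((2 + 4 * θ) / 2) := by
        gcongr
        · exact abs_centeredSpin_le θ β e Y
        · exact abs_sum_centeredSpin_sub_flip_le hθ β B e Y
    _ = 2 + 4 * θ := by ring

/-- The sub-Gaussian variance proxy, per edge, of sums of conditionally centered signs. -/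
def varProxy (θ : ℝ) : ℝ := (2 + 4 * θ) * Real.exp (2 + 4 * θ)

theorem varProxy_nonneg {θ : ℝ} (hθ : 0 ≤ θ) : 0 ≤ varProxy θ := by
  unfold varProxy
  positivity

theorem gibbsMean_sum_centeredSpin_mul_exp_le {θ l : ℝ} (hθ : 0 ≤ θ) (hl : 0 ≤ l) (hl1 : l ≤ 1)
    (β : Fin n → ℝ) (B : Finset (Edge n)) :
    gibbsMean (energy θ β) (fun Y => (∑ f ∈ B, centeredSpin θ β f Y) *
      Real.exp (l * ∑ f ∈ B, centeredSpin θ β f Y)) ≤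
      B.card * varProxy θ * l *
        gibbsMean (energy θ β) (fun Y => Real.exp (l * ∑ f ∈ B, centeredSpin θ β f Y)) := by
  simp only [Finset.sum_mul]
  rw [gibbsMean_sum, mul_assoc, mul_assoc, ← nsmul_eq_mul]
  refine Finset.sum_le_card_nsmul _ _ _ fun e _ => ?_
  rw [gibbsMean_centeredSpin_mul, ← mul_assoc, ← gibbsMean_const_mul]
  refine gibbsMean_mono fun Y => (le_abs_self _).trans ?_
  have hflip := abs_sum_centeredSpin_sub_flip_le hθ β B e Y
  set F := ∑ f ∈ B, centeredSpin θ β f Y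
  set F' := ∑ f ∈ B, centeredSpin θ β f (flip e Y)
  have hfactor : Real.exp (l * F') - Real.exp (l * F) =
      Real.exp (l * F) * (Real.exp (l * (F' - F)) - 1) := by
    rw [mul_sub, mul_one, ← Real.exp_add]
    ring_nf
  have hlF : |l * (F' - F)| ≤ l * (2 + 4 * θ) := by
    rw [abs_mul, abs_of_nonneg hl, abs_sub_comm]
    gcongr
  have hexp : |Real.exp (l * (F' - F)) - 1| ≤ l * (2 + 4 * θ) * Real.exp (2 + 4 * θ) := by
    refine (abs_exp_sub_one_le_mul_exp _).trans ?_
    gcongr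
    exact hlF.trans (mul_le_of_le_one_left (by positivity) hl1)
  rw [abs_mul, abs_div, abs_two, abs_sub_comm (Real.exp _), hfactor, abs_mul, Real.abs_exp]
  calc _ ≤ 2 * (Real.exp (l * F) * (l * (2 + 4 * θ) * Real.exp (2 + 4 * θ)) / 2) := by
        gcongr
        exact abs_centeredSpin_le θ β e Y
    _ = varProxy θ * l * Real.exp (l * F) := by unfold varProxy; ring

theorem gibbsMean_exp_sum_centeredSpin_le {θ l : ℝ} (hθ : 0 ≤ θ) (hl : 0 ≤ l) (hl1 : l ≤ 1)
    (β : Fin n → ℝ) (B : Finset (Edge n)) :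
    gibbsMean (energy θ β) (fun Y => Real.exp (l * ∑ f ∈ B, centeredSpin θ β f Y)) ≤
      Real.exp (B.card * varProxy θ * l ^ 2 / 2) := by
  refine gibbsMean_exp_le_of_gibbsMean_tilt_le hl fun u hu => ?_
  have h := gibbsMean_sum_centeredSpin_mul_exp_le hθ hu.1 (hu.2.trans hl1) β B
  rw [gibbsMean_mul_exp] at h
  refine le_of_mul_le_mul_right h (div_pos ?_ (sum_exp_pos _))
  simpa only [← Real.exp_add] using sum_exp_pos _

theorem prob_abs_sum_centeredSpin_ge_le {θ a : ℝ} (hθ : 0 ≤ θ) (ha : 0 < a) (β : Fin n → ℝ)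
    (B : Finset (Edge n)) :
    prob θ β {Y | a ≤ |∑ f ∈ B, centeredSpin θ β f Y|} ≤ B.card * (2 + 4 * θ) / a ^ 2 := by
  calc prob θ β {Y | a ≤ |∑ f ∈ B, centeredSpin θ β f Y|}
      ≤ gibbsMean (energy θ β) (fun Y => 1 / a ^ 2 * (∑ f ∈ B, centeredSpin θ β f Y) ^ 2) := by
        refine prob_le_gibbsMean θ β (fun Y => by positivity) fun Y hY => ?_
        rw [one_div_mul_eq_div, one_le_div (by positivity), ← sq_abs (∑ f ∈ B, _)]
        exact pow_le_pow_left₀ ha.le hY 2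
    _ ≤ 1 / a ^ 2 * (B.card * (2 + 4 * θ)) := by
        rw [gibbsMean_const_mul]
        gcongr
        exact gibbsMean_sq_sum_centeredSpin_le hθ β B
    _ = B.card * (2 + 4 * θ) / a ^ 2 := one_div_mul_eq_div _ _

/-- The gain in conditional mean of the edge `e` when the null parameter `β₀` is replaced by `β`. -/
def shift (θ β₀ : ℝ) (β : Fin n → ℝ) (e : Edge n) (Y : Config n) : ℝ :=
  Real.tanh (localField θ β e Y) - Real.tanh (localField θ (fun _ => β₀) e Y)

theorem centeredSpin_null_eq (θ β₀ : ℝ) (β : Fin n → ℝ) (e : Edge n) (Y : Config n) :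
    centeredSpin θ (fun _ => β₀) e Y = centeredSpin θ β e Y + shift θ β₀ β e Y := by
  unfold centeredSpin shift
  ring

theorem abs_localField_le {θ : ℝ} (hθ : 0 ≤ θ) (β₀ : ℝ) (e : Edge n) (Y : Config n) :
    |localField θ (fun _ => β₀) e Y| ≤ 4 * θ + |β₀| := by
  have hn := e.sub_one_pos
  have hvertex : ∀ i, |θ / ((n : ℝ) - 1) * (deg Y i - spin (Y e)) + β₀ / 2| ≤
      2 * θ + |β₀| / 2 := fun i => by
    have hdeg : |deg Y i - spin (Y e)| ≤ 2 * ((n : ℝ) - 1) := by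
      refine (abs_sub _ _).trans ?_
      rw [abs_spin]
      linarith [abs_deg_le Y i, e.two_le]
    refine (abs_add_le _ _).trans ?_
    rw [abs_mul, abs_of_nonneg (by positivity : 0 ≤ θ / ((n : ℝ) - 1)), abs_div, abs_two]
    calc θ / ((n : ℝ) - 1) * |deg Y i - spin (Y e)| + |β₀| / 2
        ≤ θ / ((n : ℝ) - 1) * (2 * ((n : ℝ) - 1)) + |β₀| / 2 := by gcongr
      _ = 2 * θ + |β₀| / 2 := by field_simp
  calc |localField θ (fun _ => β₀) e Y|
      ≤ ∑ i, incidence i e * (2 * θ + |β₀| / 2) := by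
        refine (Finset.abs_sum_le_sum_abs _ _).trans (Finset.sum_le_sum fun i _ => ?_)
        rw [abs_mul, abs_of_nonneg (incidence_nonneg i e)]
        exact mul_le_mul_of_nonneg_left (hvertex i) (incidence_nonneg i e)
    _ = 4 * θ + |β₀| := by
        rw [← Finset.sum_mul, sum_incidence_vertex]
        ring

/-- The factor by which the shift of an edge exceeds the signal strength at one of its endpoints. -/
def gain (θ β₀ : ℝ) : ℝ := 1 / (2 * Real.cosh (4 * θ + |β₀| + 1) ^ 2)

theorem gain_pos (θ β₀ : ℝ) : 0 < gain θ β₀ := by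
  have := Real.cosh_pos (4 * θ + |β₀| + 1)
  unfold gain
  positivity

theorem localField_add (θ β₀ : ℝ) {β μ : Fin n → ℝ} (hβ : ∀ i, β i = β₀ + μ i) (e : Edge n)
    (Y : Config n) :
    localField θ β e Y = localField θ (fun _ => β₀) e Y + (∑ i, incidence i e * μ i) / 2 := by
  unfold localField
  rw [Finset.sum_div, ← Finset.sum_add_distrib]
  exact Finset.sum_congr rfl fun i _ => by rw [hβ]; ring

theorem shift_nonneg (θ β₀ : ℝ) {β μ : Fin n → ℝ} (hβ : ∀ i, β i = β₀ + μ i)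
    (hμ : ∀ i, 0 ≤ μ i) (e : Edge n) (Y : Config n) : 0 ≤ shift θ β₀ β e Y := by
  rw [shift, sub_nonneg, localField_add θ β₀ hβ]
  exact tanh_monotone <| le_add_of_nonneg_right <| div_nonneg
    (Finset.sum_nonneg fun i _ => mul_nonneg (incidence_nonneg i e) (hμ i)) two_pos.le

theorem le_shift {θ A : ℝ} (hθ : 0 ≤ θ) (β₀ : ℝ) (hA : 0 ≤ A) (hA1 : A ≤ 1)
    {β μ : Fin n → ℝ} (hβ : ∀ i, β i = β₀ + μ i) (hμ : ∀ i, 0 ≤ μ i) {i : Fin n}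
    (hi : A ≤ μ i) {e : Edge n} (he : e.1.1 = i ∨ e.1.2 = i) (Y : Config n) :
    gain θ β₀ * A ≤ shift θ β₀ β e Y := by
  have hfield : A / 2 ≤ (∑ i, incidence i e * μ i) / 2 := by
    have hsum := Finset.single_le_sum (f := fun i => incidence i e * μ i)
      (fun i _ => mul_nonneg (incidence_nonneg i e) (hμ i)) (Finset.mem_univ i)
    simp only [incidence, if_pos he, one_mul] at hsum ⊢
    linarith
  rw [shift, localField_add θ β₀ hβ]
  refine (le_of_eq ?_).trans <| le_tanh_add_sub_tanh (abs_localField_le hθ β₀ e Y)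
    (by positivity) (by linarith) hfield
  unfold gain
  ring

theorem prob_sum_centeredSpin_null_le {θ : ℝ} (hθ : 0 ≤ θ) (β₀ : ℝ) (β : Fin n → ℝ)
    (B : Finset (Edge n)) {L : ℝ} (hL : 0 < L) (hs : ∀ Y, 2 * L ≤ ∑ e ∈ B, shift θ β₀ β e Y) :
    prob θ β {Y | ∑ e ∈ B, centeredSpin θ (fun _ => β₀) e Y ≤ L} ≤
      B.card * (2 + 4 * θ) / L ^ 2 := by
  refine (prob_mono θ β fun Y hY => ?_).trans (prob_abs_sum_centeredSpin_ge_le hθ hL β B)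
  simp only [Set.mem_ofPred_eq, centeredSpin_null_eq θ β₀ β, Finset.sum_add_distrib] at hY ⊢
  exact le_abs.2 (Or.inr (by linarith [hs Y]))

end Concentration

/-! ### Power of the conditionally centered tests -/

section Power

variable {n : ℕ}

theorem risk_nonneg (θ β₀ s A : ℝ) (T : Test n) : 0 ≤ risk θ β₀ s A T :=
  add_nonneg (prob_nonneg _ _ _) (Real.iSup_nonneg fun _ => prob_nonneg _ _ _)

theorem risk_le {θ β₀ s A x y : ℝ} {T : Test n} (hy : 0 ≤ y)
    (hnull : prob θ (fun _ => β₀) {Y | T Y = 1} ≤ x)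
    (halt : ∀ β ∈ alternatives n β₀ s A, prob θ β {Y | T Y = 0} ≤ y) :
    risk θ β₀ s A T ≤ x + y :=
  add_le_add hnull (Real.iSup_le (fun β => halt β.1 β.2) hy)

theorem card_edge_le : (Fintype.card (Edge n) : ℝ) ≤ (n : ℝ) ^ 2 := by
  have h := Fintype.card_subtype_le fun e : Fin n × Fin n => e.1 < e.2
  rw [Fintype.card_prod, Fintype.card_fin, ← sq] at h
  exact_mod_cast h

theorem nonneg_of_forall_mem_support_le {A : ℝ} {μ : Fin n → ℝ} (hA : 0 ≤ A)
    (h : ∀ i ∈ Function.support μ, A ≤ μ i) (i : Fin n) : 0 ≤ μ i :=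
  (eq_or_ne (μ i) 0).elim Eq.ge fun hi => hA.trans (h i hi)

theorem spin_sub_condMean (θ : ℝ) (β : Fin n → ℝ) (e : Edge n) (Y : Config n) :
    spin (Y e) - condMean θ β e Y = centeredSpin θ β e Y := by
  rw [condMean_eq, centeredSpin]

theorem sumTest_eq_one_iff {θ β₀ L : ℝ} {Y : Config n} :
    sumTest n θ β₀ L Y = 1 ↔ L < ∑ e, centeredSpin θ (fun _ => β₀) e Y := by
  simp [sumTest, spin_sub_condMean]

theorem sumTest_eq_zero_iff {θ β₀ L : ℝ} {Y : Config n} :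
    sumTest n θ β₀ L Y = 0 ↔ ∑ e, centeredSpin θ (fun _ => β₀) e Y ≤ L := by
  simp [sumTest, spin_sub_condMean]

theorem sum_incidence_le_shift {θ A : ℝ} (hθ : 0 ≤ θ) (β₀ : ℝ) (hA : 0 ≤ A) (hA1 : A ≤ 1)
    {β μ : Fin n → ℝ} (hβ : ∀ i, β i = β₀ + μ i) (hμ : ∀ i, 0 ≤ μ i) {S : Finset (Fin n)}
    (hS : ∀ i ∈ S, A ≤ μ i) (e : Edge n) (Y : Config n) :
    gain θ β₀ * A / 2 * ∑ i ∈ S, incidence i e ≤ shift θ β₀ β e Y := by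
  have hg := gain_pos θ β₀
  by_cases h : ∃ i ∈ S, e.1.1 = i ∨ e.1.2 = i
  · obtain ⟨i, hi, he⟩ := h
    have htwo : ∑ i ∈ S, incidence i e ≤ 2 := by
      rw [← sum_incidence_vertex e]
      exact Finset.sum_le_sum_of_subset_of_nonneg (Finset.subset_univ _)
        fun i _ _ => incidence_nonneg i e
    calc gain θ β₀ * A / 2 * ∑ i ∈ S, incidence i e ≤ gain θ β₀ * A / 2 * 2 := by gcongr
      _ = gain θ β₀ * A := div_mul_cancel₀ _ two_ne_zero
      _ ≤ shift θ β₀ β e Y := le_shift hθ β₀ hA hA1 hβ hμ (hS i hi) he Y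
  · push Not at h
    have hzero : ∑ i ∈ S, incidence i e = 0 :=
      Finset.sum_eq_zero fun i hi => if_neg (not_or.2 (h i hi))
    rw [hzero, mul_zero]
    exact shift_nonneg θ β₀ hβ hμ e Y

theorem le_sum_shift {θ A s : ℝ} (hθ : 0 ≤ θ) (β₀ : ℝ) (hA : 0 ≤ A) (hA1 : A ≤ 1)
    (hn : 1 ≤ (n : ℝ)) {β : Fin n → ℝ} (hβ : β ∈ alternatives n β₀ s A) (Y : Config n) :
    gain θ β₀ * A / 2 * (s * ((n : ℝ) - 1)) ≤ ∑ e, shift θ β₀ β e Y := by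
  classical
  obtain ⟨μ, hβ, hs, hμ⟩ := hβ
  have hg := gain_pos θ β₀
  have hn0 := sub_nonneg.2 hn
  rw [Set.ncard_eq_toFinset_card'] at hs
  calc gain θ β₀ * A / 2 * (s * ((n : ℝ) - 1))
      ≤ gain θ β₀ * A / 2 * ((Function.support μ).toFinset.card * ((n : ℝ) - 1)) := by gcongr
    _ = ∑ e : Edge n, gain θ β₀ * A / 2 * ∑ i ∈ (Function.support μ).toFinset, incidence i e := by
        rw [← Finset.mul_sum, Finset.sum_comm]
        simp only [sum_incidence_edge, Finset.sum_const, nsmul_eq_mul]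
    _ ≤ ∑ e, shift θ β₀ β e Y := Finset.sum_le_sum fun e _ =>
        sum_incidence_le_shift hθ β₀ hA hA1 hβ (nonneg_of_forall_mem_support_le hA hμ)
          (fun i hi => hμ i (Set.mem_toFinset.1 hi)) e Y

theorem risk_sumTest_le {θ A s L : ℝ} (hθ : 0 ≤ θ) (β₀ : ℝ) (hA : 0 ≤ A) (hA1 : A ≤ 1)
    (hs : 0 ≤ s) (hn : 2 ≤ (n : ℝ)) (hL : 0 < L) (hL' : L ≤ gain θ β₀ / 8 * (n * s * A)) :
    risk θ β₀ s A (sumTest n θ β₀ L) ≤ 2 * (2 + 4 * θ) * (n / L) ^ 2 := by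
  have hcard : (Finset.univ : Finset (Edge n)).card * (2 + 4 * θ) / L ^ 2 ≤
      (2 + 4 * θ) * (n / L) ^ 2 := by
    rw [div_pow, mul_div_assoc', mul_comm (2 + 4 * θ)]
    gcongr
    exact card_edge_le
  rw [two_mul, add_mul]
  refine risk_le (by positivity) ?_ fun β hβ => ?_
  · refine (prob_mono _ _ fun Y hY => ?_).trans
      ((prob_abs_sum_centeredSpin_ge_le hθ hL _ Finset.univ).trans hcard)
    exact (sumTest_eq_one_iff.1 hY).le.trans (le_abs_self _)
  · have hshift : ∀ Y, 2 * L ≤ ∑ e, shift θ β₀ β e Y := fun Y => by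
      have : 0 ≤ gain θ β₀ * A * s := by
        have := gain_pos θ β₀
        positivity
      nlinarith [le_sum_shift hθ β₀ hA hA1 (by linarith) hβ Y]
    exact (prob_mono _ _ fun Y hY => sumTest_eq_zero_iff.1 hY).trans
      ((prob_sum_centeredSpin_null_le hθ β₀ β _ hL hshift).trans hcard)

/-- The edges at a vertex. -/
def star (i : Fin n) : Finset (Edge n) := {e | e.1.1 = i ∨ e.1.2 = i}

theorem card_star (i : Fin n) : ((star i).card : ℝ) = (n : ℝ) - 1 := by
  rw [← sum_incidence_edge i]
  simp [star, incidence]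

theorem centeredDeg_eq (θ β₀ : ℝ) (i : Fin n) (Y : Config n) :
    centeredDeg θ β₀ i Y = ∑ e ∈ star i, centeredSpin θ (fun _ => β₀) e Y := by
  simp only [centeredDeg, spin_sub_condMean, star]

theorem maxTest_eq_one_iff {θ β₀ L : ℝ} {Y : Config n} :
    maxTest n θ β₀ L Y = 1 ↔ L < ⨆ i, ∑ e ∈ star i, centeredSpin θ (fun _ => β₀) e Y := by
  simp [maxTest, centeredDeg_eq]

theorem maxTest_eq_zero_iff {θ β₀ L : ℝ} {Y : Config n} :
    maxTest n θ β₀ L Y = 0 ↔ ⨆ i, ∑ e ∈ star i, centeredSpin θ (fun _ => β₀) e Y ≤ L := by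
  simp [maxTest, centeredDeg_eq]

theorem prob_maxTest_eq_one_le {θ l : ℝ} (hθ : 0 ≤ θ) (β₀ L : ℝ) (hl : 0 ≤ l) (hl1 : l ≤ 1)
    (hn : 1 ≤ n) :
    prob θ (fun _ => β₀) {Y : Config n | maxTest n θ β₀ L Y = 1} ≤
      n * Real.exp (n * varProxy θ * l ^ 2 / 2 - l * L) := by
  have : Nonempty (Fin n) := ⟨⟨0, hn⟩⟩
  have hp := varProxy_nonneg hθ
  calc prob θ (fun _ => β₀) {Y : Config n | maxTest n θ β₀ L Y = 1}
      ≤ gibbsMean (energy θ fun _ => β₀) (fun Y => ∑ i : Fin n, Real.exp (-(l * L)) *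
          Real.exp (l * ∑ e ∈ star i, centeredSpin θ (fun _ => β₀) e Y)) := by
        refine prob_le_gibbsMean θ _ (fun Y => by positivity) fun Y hY => ?_
        obtain ⟨i, hi⟩ := exists_lt_of_lt_ciSup (maxTest_eq_one_iff.1 hY)
        refine le_trans ?_ (Finset.single_le_sum (fun i _ => by positivity) (Finset.mem_univ i))
        rw [← Real.exp_add, neg_add_eq_sub, ← mul_sub]
        exact Real.one_le_exp (mul_nonneg hl (sub_pos.2 hi).le)
    _ ≤ ∑ _ : Fin n, Real.exp (-(l * L)) * Real.exp (n * varProxy θ * l ^ 2 / 2) := by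
        rw [gibbsMean_sum]
        refine Finset.sum_le_sum fun i _ => ?_
        rw [gibbsMean_const_mul]
        gcongr
        refine (gibbsMean_exp_sum_centeredSpin_le hθ hl hl1 _ _).trans ?_
        rw [card_star]
        gcongr
        exact sub_le_self _ zero_le_one
    _ = n * Real.exp (n * varProxy θ * l ^ 2 / 2 - l * L) := by
        rw [← Real.exp_add, neg_add_eq_sub]
        simp

theorem prob_maxTest_eq_zero_le {θ A s L : ℝ} (hθ : 0 ≤ θ) (β₀ : ℝ) (hA : 0 ≤ A) (hA1 : A ≤ 1)
    (hs : 0 < s) (hn : 2 ≤ (n : ℝ)) (hL : 0 < L) (hL' : L ≤ gain θ β₀ / 4 * (n * A))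
    {β : Fin n → ℝ} (hβ : β ∈ alternatives n β₀ s A) :
    prob θ β {Y | maxTest n θ β₀ L Y = 0} ≤ n * (2 + 4 * θ) / L ^ 2 := by
  obtain ⟨μ, hβ, hsupp, hμ⟩ := hβ
  obtain ⟨i, hi⟩ : (Function.support μ).Nonempty :=
    Set.nonempty_of_ncard_ne_zero (Nat.cast_pos.1 (hs.trans_le hsupp)).ne'
  have hshift : ∀ Y, 2 * L ≤ ∑ e ∈ star i, shift θ β₀ β e Y := fun Y => by
    have hsum := Finset.card_nsmul_le_sum (star i) (fun e => shift θ β₀ β e Y) (gain θ β₀ * A)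
      fun e he => le_shift hθ β₀ hA hA1 hβ (nonneg_of_forall_mem_support_le hA hμ) (hμ i hi)
        (by simpa [star] using he) Y
    rw [nsmul_eq_mul, card_star] at hsum
    nlinarith [mul_nonneg (gain_pos θ β₀).le hA]
  calc prob θ β {Y | maxTest n θ β₀ L Y = 0}
      ≤ prob θ β {Y | ∑ e ∈ star i, centeredSpin θ (fun _ => β₀) e Y ≤ L} :=
        prob_mono _ _ fun Y hY =>
          (le_ciSup (Finite.bddAbove_range _) i).trans (maxTest_eq_zero_iff.1 hY)
    _ ≤ (star i).card * (2 + 4 * θ) / L ^ 2 := prob_sum_centeredSpin_null_le hθ β₀ β _ hL hshift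
    _ ≤ n * (2 + 4 * θ) / L ^ 2 := by
        rw [card_star]
        gcongr
        exact sub_le_self _ zero_le_one

-- The moment bound is optimized at `l = √(log n / n)`.
theorem risk_maxTest_le {θ A s : ℝ} (hθ : 0 ≤ θ) (β₀ : ℝ) (hA : 0 ≤ A) (hA1 : A ≤ 1)
    (hs : 0 < s) (hn : 2 ≤ (n : ℝ))
    (hL : (varProxy θ / 2 + 2) * √(n * Real.log n) ≤ gain θ β₀ / 4 * (n * A)) :
    risk θ β₀ s A (maxTest n θ β₀ ((varProxy θ / 2 + 2) * √(n * Real.log n))) ≤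
      (n : ℝ)⁻¹ + (2 + 4 * θ) / (varProxy θ / 2 + 2) ^ 2 * (Real.log n)⁻¹ := by
  have hp := varProxy_nonneg hθ
  have hn0 : (0 : ℝ) < n := by linarith
  have hlog : 0 < Real.log n := Real.log_pos (by linarith)
  refine risk_le (by positivity) ?_ fun β hβ => ?_
  · have hl1 : √(Real.log n / n) ≤ 1 := by
      rw [Real.sqrt_le_one, div_le_one hn0]
      linarith [Real.log_le_sub_one_of_pos hn0]
    refine (prob_maxTest_eq_one_le hθ β₀ _ (Real.sqrt_nonneg _) hl1
      (by exact_mod_cast one_le_two.trans hn)).trans_eq ?_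
    have hmul : √(Real.log n / n) * √(n * Real.log n) = Real.log n := by
      rw [← Real.sqrt_mul (by positivity), div_mul_eq_mul_div, mul_left_comm,
        mul_div_cancel_left₀ _ hn0.ne', Real.sqrt_mul_self hlog.le]
    rw [mul_left_comm, hmul, Real.sq_sqrt (by positivity), mul_right_comm,
      mul_div_cancel₀ _ hn0.ne', show Real.log n * varProxy θ / 2 -
      (varProxy θ / 2 + 2) * Real.log n = -Real.log n + -Real.log n by ring, Real.exp_add,
      Real.exp_neg, Real.exp_log hn0, mul_inv_cancel_left₀ hn0.ne']
  · refine (prob_maxTest_eq_zero_le hθ β₀ hA hA1 hs hn (by positivity) hL hβ).trans_eq ?_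
    rw [mul_pow, Real.sq_sqrt (by positivity)]
    field_simp

theorem asympPowerful_sumTest {θ : ℝ} (hθ : 0 ≤ θ) (β₀ : ℝ) {s A L : ℕ → ℝ}
    (hs : ∀ᶠ n in atTop, 0 < s n) (hA : ∀ᶠ n in atTop, 0 < A n ∧ A n ≤ 1)
    (hL : Tendsto (fun n : ℕ => L n / (n : ℝ)) atTop atTop)
    (hL' : Tendsto (fun n : ℕ => L n / ((n : ℝ) * s n * A n)) atTop (𝓝 0)) :
    AsympPowerful θ β₀ s A (fun n => sumTest n θ β₀ (L n)) := by
  have hlim : Tendsto (fun n : ℕ => 2 * (2 + 4 * θ) * ((n : ℝ) / L n) ^ 2) atTop (𝓝 0) := by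
    simpa [Pi.inv_def] using (hL.inv_tendsto_atTop.pow 2).const_mul (2 * (2 + 4 * θ))
  refine squeeze_zero' (Eventually.of_forall fun n => risk_nonneg _ _ _ _ _) ?_ hlim
  filter_upwards [eventually_ge_atTop 2, hs, hA, hL.eventually_gt_atTop 0,
    hL'.eventually_le_const (div_pos (gain_pos θ β₀) (by norm_num : (0 : ℝ) < 8))]
    with n hn hs hA hL0 hLle
  have hn2 : (2 : ℝ) ≤ n := by exact_mod_cast hn
  have hn0 : (0 : ℝ) < n := by linarith
  rw [div_le_iff₀ (mul_pos (mul_pos hn0 hs) hA.1)] at hLle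
  exact risk_sumTest_le hθ β₀ hA.1.le hA.2 hs.le hn2 ((div_pos_iff_of_pos_right hn0).1 hL0) hLle

theorem asympPowerful_maxTest {θ : ℝ} (hθ : 0 ≤ θ) (β₀ : ℝ) {s A : ℕ → ℝ}
    (hs : ∀ᶠ n in atTop, 0 < s n) (hA : ∀ᶠ n in atTop, 0 < A n ∧ A n ≤ 1)
    (hlim : Tendsto (fun n : ℕ => √(n * Real.log n) / ((n : ℝ) * A n)) atTop (𝓝 0)) :
    AsympPowerful θ β₀ s A
      (fun n => maxTest n θ β₀ ((varProxy θ / 2 + 2) * √((n : ℝ) * Real.log n))) := by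
  have hbound : Tendsto (fun n : ℕ => (n : ℝ)⁻¹ +
      (2 + 4 * θ) / (varProxy θ / 2 + 2) ^ 2 * (Real.log n)⁻¹) atTop (𝓝 0) := by
    simpa using tendsto_inv_atTop_nhds_zero_nat.add (((Real.tendsto_log_atTop.comp
      tendsto_natCast_atTop_atTop).inv_tendsto_atTop).const_mul
        ((2 + 4 * θ) / (varProxy θ / 2 + 2) ^ 2))
  refine squeeze_zero' (Eventually.of_forall fun n => risk_nonneg _ _ _ _ _) ?_ hbound
  filter_upwards [eventually_ge_atTop 2, hs, hA, (hlim.const_mul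
    (varProxy θ / 2 + 2)).eventually_le_const (by
      rw [mul_zero]; exact div_pos (gain_pos θ β₀) four_pos)] with n hn hs hA hLle
  have hn2 : (2 : ℝ) ≤ n := by exact_mod_cast hn
  rw [mul_div_assoc', div_le_iff₀ (mul_pos (by linarith) hA.1)] at hLle
  exact risk_maxTest_le hθ β₀ hA.1.le hA.2 hs hn2 hLle

end Power

/-! ### Covariances of the degrees -/

section Covariance

variable {n : ℕ}

/-- The linear combination of the degrees with coefficients `w`. Perturbations of the field `β`
change the energy by such combinations. -/
def weightedDeg (w : Fin n → ℝ) (Y : Config n) : ℝ := ∑ i, w i * deg Y i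

/-- The sum of all the signs, an affine function of the number of edges. -/
def totalSpin (Y : Config n) : ℝ := ∑ e, spin (Y e)

theorem weightedDeg_eq_linForm (w : Fin n → ℝ) :
    weightedDeg w = linForm fun e => ∑ i, w i * incidence i e := by
  funext Y
  simp only [weightedDeg, deg_eq_linForm, linForm, Finset.mul_sum, Finset.sum_mul, mul_assoc]
  exact Finset.sum_comm

theorem weightedDeg_const_mul (c : ℝ) (w : Fin n → ℝ) :
    weightedDeg (fun i => c * w i) = fun Y => c * weightedDeg w Y := by
  funext Y
  simp only [weightedDeg, Finset.mul_sum, mul_assoc]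

theorem weightedDeg_half (Y : Config n) : weightedDeg (fun _ => 1 / 2) Y = totalSpin Y := by
  rw [weightedDeg_eq_linForm, linForm, totalSpin]
  simp only [← Finset.mul_sum, sum_incidence_vertex]
  norm_num

theorem energy_add_mul (θ : ℝ) (β μ : Fin n → ℝ) (t : ℝ) :
    energy θ (fun i => β i + t * μ i) =
      fun Y => energy θ β Y + t * weightedDeg (fun i => 1 / 2 * μ i) Y := by
  funext Y
  simp only [energy, weightedDeg, add_mul, Finset.sum_add_distrib, mul_assoc, ← Finset.mul_sum]
  ring

theorem coupling_nonneg {θ : ℝ} (hθ : 0 ≤ θ) (hn : 1 ≤ n) : 0 ≤ θ / (2 * ((n : ℝ) - 1)) := by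
  have : (1 : ℝ) ≤ n := by exact_mod_cast hn
  exact div_nonneg hθ (by linarith)

theorem energy_eq_ferroEnergy {θ : ℝ} (hθ : 0 ≤ θ) (hn : 1 ≤ n) (β : Fin n → ℝ) :
    energy θ β = ferroEnergy (fun i e => √(θ / (2 * ((n : ℝ) - 1))) * incidence i e)
      (fun e => ∑ i, 1 / 2 * β i * incidence i e) := by
  funext Y
  have hlin : ∀ i, linForm (fun e => √(θ / (2 * ((n : ℝ) - 1))) * incidence i e) Y =
      √(θ / (2 * ((n : ℝ) - 1))) * deg Y i := fun i => by
    simp only [deg_eq_linForm, linForm, Finset.mul_sum, mul_assoc]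
  simp only [energy, ferroEnergy, hlin, mul_pow, Real.sq_sqrt (coupling_nonneg hθ hn),
    ← Finset.mul_sum]
  rw [← weightedDeg_eq_linForm, weightedDeg_const_mul]
  rfl

theorem gibbsCum_weightedDeg_nonpos {θ : ℝ} (hθ : 0 ≤ θ) (hn : 1 ≤ n) {β u v w : Fin n → ℝ}
    (hβ : 0 ≤ β) (hu : 0 ≤ u) (hv : 0 ≤ v) (hw : 0 ≤ w) :
    gibbsCum (energy θ β) (weightedDeg u) (weightedDeg v) (weightedDeg w) ≤ 0 := by
  have hsum : ∀ {w : Fin n → ℝ}, 0 ≤ w → ∀ e : Edge n, 0 ≤ ∑ i, w i * incidence i e :=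
    fun hw e => Finset.sum_nonneg fun i _ => mul_nonneg (hw i) (incidence_nonneg i e)
  rw [energy_eq_ferroEnergy hθ hn]
  simp only [weightedDeg_eq_linForm]
  exact gibbsCum_ferroEnergy_nonpos
    (fun i e => mul_nonneg (Real.sqrt_nonneg _) (incidence_nonneg i e))
    (hsum fun i => mul_nonneg (by norm_num) (hβ i)) (hsum hu) (hsum hv) (hsum hw)

theorem gibbsCov_weightedDeg_anti {θ : ℝ} (hθ : 0 ≤ θ) (hn : 1 ≤ n) {ρ β u v : Fin n → ℝ}
    (hρ : 0 ≤ ρ) (hβ : ρ ≤ β) (hu : 0 ≤ u) (hv : 0 ≤ v) :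
    gibbsCov (energy θ β) (weightedDeg u) (weightedDeg v) ≤
      gibbsCov (energy θ ρ) (weightedDeg u) (weightedDeg v) := by
  have hmvt := sub_le_of_hasDerivAt_le (C := 0)
    (hasDerivAt_gibbsCov (energy θ ρ) (weightedDeg fun i => 1 / 2 * (β i - ρ i)) (weightedDeg u)
      (weightedDeg v)) fun t ht => by
        rw [← energy_add_mul]
        exact gibbsCum_weightedDeg_nonpos hθ hn
          (fun i => add_nonneg (hρ i) (mul_nonneg ht.1 (sub_nonneg.2 (hβ i)))) hu hv
          fun i => mul_nonneg (by norm_num) (sub_nonneg.2 (hβ i))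
  simp only [← energy_add_mul] at hmvt
  simp only [one_mul, zero_mul, add_zero, add_sub_cancel] at hmvt
  linarith

theorem deg_neg (Y : Config n) (i : Fin n) : deg (-Y) i = -deg Y i := by
  simp only [deg_eq_linForm, linForm, Pi.neg_apply, spin_neg, mul_neg, Finset.sum_neg_distrib]

theorem gibbsCov_energy_neg (θ : ℝ) (β u v : Fin n → ℝ) :
    gibbsCov (energy θ (-β)) (weightedDeg u) (weightedDeg v) =
      gibbsCov (energy θ β) (weightedDeg u) (weightedDeg v) := by
  have henergy : (fun Y : Config n => energy θ β (-Y)) = energy θ (-β) := by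
    funext Y
    simp only [energy, deg_neg, neg_sq, Pi.neg_apply, neg_mul, mul_neg]
  have hdeg : ∀ w : Fin n → ℝ, (fun Y : Config n => weightedDeg w (-Y)) =
      fun Y => (-1) * weightedDeg w Y := fun w => by
    funext Y
    simp only [weightedDeg, deg_neg, mul_neg, Finset.sum_neg_distrib, neg_mul, one_mul]
  have hcomp := gibbsCov_comp_equiv (Equiv.neg (Config n)) (energy θ β) (weightedDeg u)
    (weightedDeg v)
  simp only [Equiv.neg_apply, henergy, hdeg, gibbsCov_const_mul_left,
    gibbsCov_const_mul_right] at hcomp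
  linarith

/-! ### Positive association -/

theorem spin_mono : Monotone spin := fun u v h => by
  have : (u : ℤ) ≤ (v : ℤ) := h
  unfold spin
  exact_mod_cast this

theorem spin_inf_add_sup (u v : ℤˣ) : spin (u ⊓ v) + spin (u ⊔ v) = spin u + spin v := by
  rcases le_total u v with h | h
  · rw [inf_eq_left.2 h, sup_eq_right.2 h]
  · rw [inf_eq_right.2 h, sup_eq_left.2 h, add_comm]

theorem linForm_mono {E : Type*} [Fintype E] {c : E → ℝ} (hc : 0 ≤ c) : Monotone (linForm c) :=
  fun _ _ h => Finset.sum_le_sum fun e _ => mul_le_mul_of_nonneg_left (spin_mono (h e)) (hc e)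

theorem deg_mono (i : Fin n) : Monotone fun Y : Config n => deg Y i := by
  simp only [deg_eq_linForm]
  exact linForm_mono (incidence_nonneg i)

theorem totalSpin_mono : Monotone (totalSpin : Config n → ℝ) :=
  fun _ _ h => Finset.sum_le_sum fun e _ => spin_mono (h e)

theorem deg_inf_add_sup (X Y : Config n) (i : Fin n) :
    deg (X ⊓ Y) i + deg (X ⊔ Y) i = deg X i + deg Y i := by
  simp only [deg_eq_linForm, linForm, ← Finset.sum_add_distrib, ← mul_add]
  exact Finset.sum_congr rfl fun e _ => congrArg _ (spin_inf_add_sup (X e) (Y e))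

theorem energy_supermodular {θ : ℝ} (hθ : 0 ≤ θ) (hn : 1 ≤ n) (β : Fin n → ℝ) (X Y : Config n) :
    energy θ β X + energy θ β Y ≤ energy θ β (X ⊓ Y) + energy θ β (X ⊔ Y) := by
  have hlin : ∑ i, β i * deg X i + ∑ i, β i * deg Y i =
      ∑ i, β i * deg (X ⊓ Y) i + ∑ i, β i * deg (X ⊔ Y) i := by
    simp only [← Finset.sum_add_distrib, ← mul_add, deg_inf_add_sup]
  have hsq : ∑ i, deg X i ^ 2 + ∑ i, deg Y i ^ 2 ≤
      ∑ i, deg (X ⊓ Y) i ^ 2 + ∑ i, deg (X ⊔ Y) i ^ 2 := by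
    simp only [← Finset.sum_add_distrib]
    refine Finset.sum_le_sum fun i _ => ?_
    have hX : deg X i ≤ deg (X ⊔ Y) i := deg_mono i le_sup_left
    have hY : deg Y i ≤ deg (X ⊔ Y) i := deg_mono i le_sup_right
    rw [eq_sub_of_add_eq (deg_inf_add_sup X Y i)]
    nlinarith [mul_nonneg (sub_nonneg.2 hX) (sub_nonneg.2 hY)]
  have := mul_le_mul_of_nonneg_left hsq (coupling_nonneg hθ hn)
  unfold energy
  linarith

theorem gibbsCov_energy_nonneg {θ : ℝ} (hθ : 0 ≤ θ) (hn : 1 ≤ n) (β : Fin n → ℝ)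
    {F G : Config n → ℝ} (hF : Monotone F) (hG : Monotone G) : 0 ≤ gibbsCov (energy θ β) F G :=
  gibbsCov_nonneg_of_monotone (energy_supermodular hθ hn β) hF hG

/-! ### The variance of the number of edges -/

theorem sum_deg_eq (Y : Config n) : ∑ i, deg Y i = 2 * totalSpin Y := by
  rw [← weightedDeg_half, weightedDeg, ← Finset.mul_sum]
  ring

theorem card_edge_eq : (Fintype.card (Edge n) : ℝ) = n * ((n : ℝ) - 1) / 2 := by
  have hcount : ∑ e : Edge n, ∑ i, incidence i e = ∑ i : Fin n, ∑ e, incidence i e :=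
    Finset.sum_comm
  simp only [sum_incidence_vertex, sum_incidence_edge, Finset.sum_const, Finset.card_univ,
    nsmul_eq_mul, Fintype.card_fin] at hcount
  linarith

theorem abs_totalSpin_le (Y : Config n) : |totalSpin Y| ≤ n * ((n : ℝ) - 1) / 2 := by
  rw [← card_edge_eq, totalSpin]
  refine (Finset.abs_sum_le_sum_abs _ _).trans_eq ?_
  simp [abs_spin]

theorem sum_localField (θ : ℝ) (β : Fin n → ℝ) (hn : 2 ≤ n) (Y : Config n) :
    ∑ e, localField θ β e Y = 2 * θ * (((n : ℝ) - 2) / ((n : ℝ) - 1)) * totalSpin Y +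
      ∑ e, ∑ i, incidence i e * (β i / 2) := by
  have hn1 : (n : ℝ) - 1 ≠ 0 := by
    have : (2 : ℝ) ≤ n := by exact_mod_cast hn
    linarith
  have hdeg : ∑ e, ∑ i, incidence i e * deg Y i = ((n : ℝ) - 1) * (2 * totalSpin Y) := by
    rw [Finset.sum_comm, ← sum_deg_eq, Finset.mul_sum]
    exact Finset.sum_congr rfl fun i _ => by rw [← Finset.sum_mul, sum_incidence_edge]
  have hspin : ∑ e, ∑ i, incidence i e * spin (Y e) = 2 * totalSpin Y := by
    rw [totalSpin, Finset.mul_sum]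
    exact Finset.sum_congr rfl fun e _ => by rw [← Finset.sum_mul, sum_incidence_vertex]
  simp only [localField, mul_add, mul_sub, mul_left_comm (incidence _ _) (θ / ((n : ℝ) - 1)),
    Finset.sum_add_distrib, Finset.sum_sub_distrib, ← Finset.mul_sum, hdeg, hspin]
  field_simp
  ring

theorem localField_mono {θ : ℝ} (hθ : 0 ≤ θ) (β : Fin n → ℝ) (e : Edge n) :
    Monotone (localField θ β e) := by
  intro X Y h
  have hdeg : ∀ (Z : Config n) (i : Fin n), incidence i e * (deg Z i - spin (Z e)) =
      incidence i e * ∑ f ∈ Finset.univ.erase e, incidence i f * spin (Z f) := fun Z i => by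
    have := Finset.add_sum_erase Finset.univ (fun f => incidence i f * spin (Z f))
      (Finset.mem_univ e)
    rw [deg_eq_linForm, linForm, ← this]
    linear_combination spin (Z e) * incidence_mul_self i e
  have hκ : 0 ≤ θ / ((n : ℝ) - 1) := div_nonneg hθ e.sub_one_pos.le
  simp only [localField, mul_add, mul_left_comm (incidence _ _) (θ / ((n : ℝ) - 1)), hdeg]
  gcongr with i _ f
  · exact incidence_nonneg i e
  · exact incidence_nonneg i f
  · exact spin_mono (h f)

theorem gibbsCov_centeredSpin_eq_zero (θ : ℝ) (β : Fin n → ℝ) (e : Edge n) {G : Config n → ℝ}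
    (hG : ∀ Y, G (flip e Y) = G Y) : gibbsCov (energy θ β) (centeredSpin θ β e) G = 0 := by
  have hmean := gibbsMean_centeredSpin_mul_eq_zero θ β e (G := fun _ => 1) fun _ => rfl
  simp only [mul_one] at hmean
  rw [gibbsCov, gibbsMean_centeredSpin_mul_eq_zero θ β e hG, hmean, zero_mul, sub_zero]

theorem gibbsCov_spin_le_gibbsCov_localField {θ : ℝ} (hθ : 0 ≤ θ) (β : Fin n → ℝ) (e : Edge n)
    {G : Config n → ℝ} (hG : Monotone G) (hflip : ∀ Y, G (flip e Y) = G Y) :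
    gibbsCov (energy θ β) (fun Y => spin (Y e)) G ≤
      gibbsCov (energy θ β) (localField θ β e) G := by
  have hn : 1 ≤ n := e.1.1.pos
  have htanh : gibbsCov (energy θ β) (fun Y => spin (Y e)) G =
      gibbsCov (energy θ β) (fun Y => Real.tanh (localField θ β e Y)) G := by
    have hzero := gibbsCov_centeredSpin_eq_zero θ β e hflip
    unfold centeredSpin at hzero
    rwa [gibbsCov_sub_left, sub_eq_zero] at hzero
  have hmono : Monotone fun Y => localField θ β e Y - Real.tanh (localField θ β e Y) :=
    fun X Y h => by
      have hle := localField_mono hθ β e h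
      have hlip := (le_abs_self _).trans
        (abs_tanh_sub_tanh_le (localField θ β e Y) (localField θ β e X))
      rw [abs_of_nonneg (sub_nonneg.2 hle)] at hlip
      dsimp only
      linarith
  have hcov := gibbsCov_energy_nonneg hθ hn β hmono hG
  rw [gibbsCov_sub_left, sub_nonneg] at hcov
  exact htanh.trans_le hcov

theorem gibbsCov_spin_totalSpin_le {θ : ℝ} (hθ : 0 ≤ θ) (β : Fin n → ℝ) (e : Edge n) :
    gibbsCov (energy θ β) (fun Y => spin (Y e)) totalSpin ≤
      1 + gibbsCov (energy θ β) (localField θ β e) totalSpin := by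
  set R : Config n → ℝ := fun Y => ∑ f ∈ Finset.univ.erase e, spin (Y f)
  have hspin : Monotone fun Y : Config n => spin (Y e) := fun _ _ h => spin_mono (h e)
  have hR : Monotone R := fun _ _ h => Finset.sum_le_sum fun f _ => spin_mono (h f)
  have hflip : ∀ Y, R (flip e Y) = R Y := fun Y => Finset.sum_congr rfl fun f hf => by
    rw [flip, Function.update_of_ne (Finset.ne_of_mem_erase hf)]
  have hsplit : ∀ X : Config n → ℝ, gibbsCov (energy θ β) X totalSpin =
      gibbsCov (energy θ β) X (fun Y => spin (Y e)) + gibbsCov (energy θ β) X R := fun X => by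
    rw [gibbsCov_comm _ X, gibbsCov_comm _ X, gibbsCov_comm _ X, ← gibbsCov_add_left]
    congr 1 with Y
    exact (Finset.add_sum_erase _ _ (Finset.mem_univ e)).symm
  have hvar : gibbsCov (energy θ β) (fun Y => spin (Y e)) (fun Y => spin (Y e)) ≤ 1 := by
    simp only [gibbsCov, spin_mul_self, gibbsMean_const]
    exact sub_le_self _ (mul_self_nonneg _)
  have hrest := gibbsCov_spin_le_gibbsCov_localField hθ β e hR hflip
  have hself := gibbsCov_energy_nonneg hθ e.1.1.pos β (localField_mono hθ β e) hspin
  rw [hsplit, hsplit]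
  linarith

theorem gibbsCov_totalSpin_le {θ : ℝ} (hθ : 0 ≤ θ) (hθ' : θ < 1 / 2) (hn : 2 ≤ n)
    (β : Fin n → ℝ) :
    gibbsCov (energy θ β) totalSpin totalSpin ≤ 1 / (2 * (1 - 2 * θ)) * (n * ((n : ℝ) - 1)) := by
  have hn2 : (2 : ℝ) ≤ n := by exact_mod_cast hn
  set V := gibbsCov (energy (n := n) θ β) totalSpin totalSpin
  have hV : 0 ≤ V := gibbsCov_energy_nonneg hθ (by omega) β totalSpin_mono totalSpin_mono
  have hratio : ((n : ℝ) - 2) / ((n : ℝ) - 1) ≤ 1 := by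
    rw [div_le_one (by linarith)]
    linarith
  have hself : V ≤ n * ((n : ℝ) - 1) / 2 + 2 * θ * V :=
    calc V = ∑ e, gibbsCov (energy θ β) (fun Y => spin (Y e)) totalSpin :=
          gibbsCov_sum_left Finset.univ _ (fun e (Y : Config n) => spin (Y e)) _
      _ ≤ ∑ e, (1 + gibbsCov (energy θ β) (localField θ β e) totalSpin) :=
          Finset.sum_le_sum fun e _ => gibbsCov_spin_totalSpin_le hθ β e
      _ = n * ((n : ℝ) - 1) / 2 + 2 * θ * (((n : ℝ) - 2) / ((n : ℝ) - 1)) * V := by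
          rw [Finset.sum_add_distrib, ← gibbsCov_sum_left, Finset.sum_const, Finset.card_univ,
            nsmul_eq_mul, mul_one, card_edge_eq]
          simp only [sum_localField θ β hn]
          rw [gibbsCov_add_const_left, gibbsCov_const_mul_left]
      _ ≤ n * ((n : ℝ) - 1) / 2 + 2 * θ * 1 * V := by gcongr
      _ = _ := by rw [mul_one]
  rw [div_mul_eq_mul_div, le_div_iff₀ (by linarith)]
  linarith

theorem gibbsCov_totalSpin_le_of_pos {θ r : ℝ} (hθ : 0 ≤ θ) (hn : 1 ≤ n) (hr : 0 < r) :
    gibbsCov (energy (n := n) θ fun _ => r) totalSpin totalSpin ≤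
      1 / r * (n * ((n : ℝ) - 1)) := by
  have hhalf : (totalSpin : Config n → ℝ) = weightedDeg fun _ => 1 / 2 :=
    funext fun Y => (weightedDeg_half Y).symm
  have henergy : ∀ t : ℝ, (fun Y : Config n => energy θ (fun _ => 0) Y + t * totalSpin Y) =
      energy θ fun _ => t := fun t => by
    simpa [hhalf] using (energy_add_mul θ (fun _ : Fin n => 0) (fun _ => 1) t).symm
  set V := gibbsCov (energy (n := n) θ fun _ => r) totalSpin totalSpin
  have hderiv : ∀ t, HasDerivAt (fun t => gibbsMean (energy (n := n) θ fun _ => t) totalSpin)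
      (gibbsCov (energy (n := n) θ fun _ => t) totalSpin totalSpin) t := fun t => by
    simpa only [henergy] using
      hasDerivAt_gibbsMean (energy (n := n) θ fun _ => 0) totalSpin totalSpin t
  have hV : ∀ t ∈ interior (Set.Icc 0 r),
      V ≤ deriv (fun t => gibbsMean (energy (n := n) θ fun _ => t) totalSpin) t := fun t ht => by
    rw [(hderiv t).deriv]
    simp only [V, hhalf]
    exact gibbsCov_weightedDeg_anti hθ hn (fun _ => (interior_subset ht).1)
      (fun _ => (interior_subset ht).2) (fun _ => by norm_num) fun _ => by norm_num
  have hmvt := (convex_Icc 0 r).mul_sub_le_image_sub_of_le_deriv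
    (fun t _ => (hderiv t).continuousAt.continuousWithinAt)
    (fun t _ => (hderiv t).differentiableAt.differentiableWithinAt) hV
    0 (Set.left_mem_Icc.2 hr.le) r (Set.right_mem_Icc.2 hr.le) hr.le
  have hmean : ∀ H : Config n → ℝ, |gibbsMean H totalSpin| ≤ n * ((n : ℝ) - 1) / 2 := fun H =>
    (abs_gibbsMean_le _ _).trans ((gibbsMean_mono abs_totalSpin_le).trans_eq (gibbsMean_const H _))
  have hbound_r := abs_le.1 (hmean (energy θ fun _ => r))
  have hbound_0 := abs_le.1 (hmean (energy θ fun _ => 0))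
  rw [div_mul_eq_mul_div, le_div_iff₀ hr]
  linarith

/-! ### Exchangeability -/

/-- The action of a vertex permutation on edges. -/
def edgeMap (σ : Equiv.Perm (Fin n)) (e : Edge n) : Edge n :=
  if h : σ e.1.1 < σ e.1.2 then ⟨(σ e.1.1, σ e.1.2), h⟩
  else ⟨(σ e.1.2, σ e.1.1), lt_of_le_of_ne (not_lt.1 h) fun h' =>
    absurd (σ.injective h') (ne_of_gt e.2)⟩

theorem edgeMap_inv (σ : Equiv.Perm (Fin n)) (e : Edge n) : edgeMap σ⁻¹ (edgeMap σ e) = e := by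
  obtain ⟨⟨a, b⟩, hab : a < b⟩ := e
  by_cases h : σ a < σ b
  · simp [edgeMap, h, hab]
  · simp [edgeMap, h, not_lt_of_ge hab.le]

/-- The action of a vertex permutation on edges, as a permutation. -/
def edgePerm (σ : Equiv.Perm (Fin n)) : Equiv.Perm (Edge n) :=
  ⟨edgeMap σ, edgeMap σ⁻¹, edgeMap_inv σ, fun e => by simpa using edgeMap_inv σ⁻¹ e⟩

theorem incidence_edgePerm (σ : Equiv.Perm (Fin n)) (i : Fin n) (e : Edge n) :
    incidence (σ i) (edgePerm σ e) = incidence i e := by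
  change incidence (σ i) (edgeMap σ e) = incidence i e
  unfold incidence edgeMap
  split_ifs <;> simp_all [or_comm]

theorem deg_comp_edgePerm (σ : Equiv.Perm (Fin n)) (Y : Config n) (i : Fin n) :
    deg (Y ∘ edgePerm σ) i = deg Y (σ i) := by
  simp only [deg_eq_linForm, linForm]
  rw [← Equiv.sum_comp (edgePerm σ) fun e => incidence (σ i) e * spin (Y e)]
  simp only [incidence_edgePerm, Function.comp_apply]

theorem gibbsCov_deg_perm (θ r : ℝ) (σ : Equiv.Perm (Fin n)) (i j : Fin n) :
    gibbsCov (energy θ fun _ => r) (fun Y => deg Y (σ i)) (fun Y => deg Y (σ j)) =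
      gibbsCov (energy θ fun _ => r) (fun Y => deg Y i) (fun Y => deg Y j) := by
  have henergy : ∀ Y : Config n,
      energy θ (fun _ => r) (Y ∘ edgePerm σ) = energy θ (fun _ => r) Y := fun Y => by
    simp only [energy, deg_comp_edgePerm]
    rw [Equiv.sum_comp σ fun i => deg Y i ^ 2, Equiv.sum_comp σ fun i => r * deg Y i]
  have hcomp := gibbsCov_comp_equiv ((edgePerm σ).symm.arrowCongr (Equiv.refl ℤˣ))
    (energy θ fun _ => r) (fun Y => deg Y i) (fun Y => deg Y j)
  have hcongr : ∀ Y : Config n,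
      (edgePerm σ).symm.arrowCongr (Equiv.refl ℤˣ) Y = Y ∘ edgePerm σ := fun Y => rfl
  simpa only [hcongr, henergy, deg_comp_edgePerm] using hcomp

theorem gibbsCov_weightedDeg_eq_sum (H : Config n → ℝ) (u v : Fin n → ℝ) :
    gibbsCov H (weightedDeg u) (weightedDeg v) =
      ∑ i, ∑ j, u i * v j * gibbsCov H (fun Y => deg Y i) (fun Y => deg Y j) := by
  change gibbsCov H (fun Y => ∑ i, u i * deg Y i) (fun Y => ∑ j, v j * deg Y j) = _
  rw [gibbsCov_sum_left]
  refine Finset.sum_congr rfl fun i _ => ?_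
  rw [gibbsCov_sum_right]
  refine Finset.sum_congr rfl fun j _ => ?_
  rw [gibbsCov_const_mul_left, gibbsCov_const_mul_right, mul_assoc]

theorem sum_gibbsCov_deg (H : Config n → ℝ) :
    ∑ i, ∑ j, gibbsCov H (fun Y => deg Y i) (fun Y => deg Y j) =
      4 * gibbsCov H totalSpin totalSpin := by
  rw [← funext weightedDeg_half, gibbsCov_weightedDeg_eq_sum]
  simp only [← Finset.mul_sum]
  ring

section VarianceBound

variable {θ r K : ℝ} (hθ : 0 ≤ θ) (hn : 2 ≤ n)
  (hK : gibbsCov (energy (n := n) θ fun _ => r) totalSpin totalSpin ≤ K * (n * ((n : ℝ) - 1)))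
include hθ hn hK

theorem gibbsCov_deg_self_le (i : Fin n) :
    gibbsCov (energy θ fun _ => r) (fun Y => deg Y i) (fun Y => deg Y i) ≤
      4 * K * ((n : ℝ) - 1) := by
  set V : Fin n → Fin n → ℝ := fun i j =>
    gibbsCov (energy θ fun _ => r) (fun Y => deg Y i) (fun Y => deg Y j)
  have hrow : ∀ a ∈ Finset.univ, V i i ≤ ∑ b, V a b := fun a _ => by
    have hperm : V a a = V i i := by
      simpa only [Equiv.swap_apply_left] using gibbsCov_deg_perm θ r (Equiv.swap i a) i i
    rw [← hperm]
    exact Finset.single_le_sum (fun b _ => gibbsCov_energy_nonneg hθ (by omega) _ (deg_mono a)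
      (deg_mono b)) (Finset.mem_univ a)
  have hsum := (Finset.card_nsmul_le_sum _ _ _ hrow).trans_eq (sum_gibbsCov_deg _)
  rw [Finset.card_univ, Fintype.card_fin, nsmul_eq_mul] at hsum
  refine le_of_mul_le_mul_left (a := (n : ℝ)) ?_ (by exact_mod_cast (by omega : 0 < n))
  linarith

theorem gibbsCov_deg_le_of_ne {i j : Fin n} (hij : i ≠ j) :
    gibbsCov (energy θ fun _ => r) (fun Y => deg Y i) (fun Y => deg Y j) ≤ 4 * K := by
  have hn2 : (2 : ℝ) ≤ n := by exact_mod_cast hn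
  set V : Fin n → Fin n → ℝ := fun i j =>
    gibbsCov (energy θ fun _ => r) (fun Y => deg Y i) (fun Y => deg Y j)
  have hrow : ∀ a ∈ Finset.univ, ((n : ℝ) - 1) * V i j ≤ ∑ b, V a b := fun a _ => by
    have hperm : ∀ b ∈ Finset.univ.erase a, V i j ≤ V a b := fun b hb => by
      obtain ⟨σ, hi, hj⟩ := MulAction.is_two_pretransitive_iff.1
        (Equiv.Perm.isMultiplyPretransitive (Fin n) 2) hij (Finset.ne_of_mem_erase hb).symm
      rw [Equiv.Perm.smul_def] at hi hj
      exact hi ▸ hj ▸ (gibbsCov_deg_perm θ r σ i j).ge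
    have hsum := Finset.card_nsmul_le_sum _ _ _ hperm
    rw [Finset.card_erase_of_mem (Finset.mem_univ a), Finset.card_univ, Fintype.card_fin,
      nsmul_eq_mul, Nat.cast_sub (by omega), Nat.cast_one] at hsum
    exact hsum.trans (Finset.sum_le_sum_of_subset_of_nonneg (Finset.erase_subset a _) fun b _ _ =>
      gibbsCov_energy_nonneg hθ (by omega) _ (deg_mono a) (deg_mono b))
  have hsum := (Finset.card_nsmul_le_sum _ _ _ hrow).trans_eq (sum_gibbsCov_deg _)
  rw [Finset.card_univ, Fintype.card_fin, nsmul_eq_mul] at hsum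
  refine le_of_mul_le_mul_left (a := n * ((n : ℝ) - 1)) ?_
    (mul_pos (by linarith) (by linarith))
  linarith

theorem gibbsCov_weightedDeg_le (hK0 : 0 ≤ K) {u v : Fin n → ℝ} (hu : 0 ≤ u) (hv : 0 ≤ v) :
    gibbsCov (energy θ fun _ => r) (weightedDeg u) (weightedDeg v) ≤
      4 * K * (n * ∑ i, u i * v i + (∑ i, u i) * ∑ i, v i) := by
  have hdeg : ∀ i j, gibbsCov (energy (n := n) θ fun _ => r) (fun Y => deg Y i)
      (fun Y => deg Y j) ≤ (if i = j then 4 * K * n else 0) + 4 * K := fun i j => by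
    split_ifs with hij
    · subst hij
      linarith [gibbsCov_deg_self_le hθ hn hK i]
    · linarith [gibbsCov_deg_le_of_ne hθ hn hK hij]
  calc gibbsCov (energy θ fun _ => r) (weightedDeg u) (weightedDeg v)
      ≤ ∑ i, ∑ j, u i * v j * ((if i = j then 4 * K * n else 0) + 4 * K) := by
        rw [gibbsCov_weightedDeg_eq_sum]
        gcongr with i _ j
        · exact mul_nonneg (hu i) (hv j)
        · exact hdeg i j
    _ = _ := by
        simp only [mul_add, mul_ite, mul_zero, Finset.sum_add_distrib, Finset.sum_ite_eq,
          Finset.mem_univ, if_true, ← Finset.sum_mul, Finset.sum_mul_sum]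
        ring

end VarianceBound

end Covariance

/-! ### The second moment of the likelihood ratio -/

section Likelihood

variable {Ω ι : Type*} [Fintype Ω] [Fintype ι]

/-- The logarithm of the partition function of the Hamiltonian `H`. -/
def logPartition (H : Ω → ℝ) : ℝ := Real.log (∑ ω, Real.exp (H ω))

/-- The probability mass function of the Gibbs measure with Hamiltonian `H`. -/
def gibbsProb (H : Ω → ℝ) (ω : Ω) : ℝ := Real.exp (H ω - logPartition H)

theorem gibbsProb_pos (H : Ω → ℝ) (ω : Ω) : 0 < gibbsProb H ω := Real.exp_pos _

theorem exp_logPartition [Nonempty Ω] (H : Ω → ℝ) :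
    Real.exp (logPartition H) = ∑ ω, Real.exp (H ω) := Real.exp_log (sum_exp_pos H)

theorem gibbsProb_eq_div [Nonempty Ω] (H : Ω → ℝ) (ω : Ω) :
    gibbsProb H ω = Real.exp (H ω) / ∑ ω, Real.exp (H ω) := by
  rw [gibbsProb, Real.exp_sub, exp_logPartition]

theorem sum_gibbsProb [Nonempty Ω] (H : Ω → ℝ) : ∑ ω, gibbsProb H ω = 1 := by
  simp only [gibbsProb_eq_div, ← Finset.sum_div]
  exact div_self (sum_exp_pos H).ne'

theorem sum_gibbsProb_mul_div [Nonempty Ω] (H F G : Ω → ℝ) :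
    ∑ ω, gibbsProb (H + F) ω * gibbsProb (H + G) ω / gibbsProb H ω =
      Real.exp (logPartition (H + F + G) - logPartition (H + F) -
        (logPartition (H + G) - logPartition H)) := by
  have hterm : ∀ ω, gibbsProb (H + F) ω * gibbsProb (H + G) ω / gibbsProb H ω =
      Real.exp ((H + F + G) ω) *
        Real.exp (-logPartition (H + F) - (logPartition (H + G) - logPartition H)) := fun ω => by
    simp only [gibbsProb, ← Real.exp_add, ← Real.exp_sub, Pi.add_apply]
    ring_nf
  simp only [hterm, ← Finset.sum_mul]
  rw [← exp_logPartition, ← Real.exp_add]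
  ring_nf

theorem logPartition_mixed_le [Nonempty Ω] {H F G : Ω → ℝ} {B : ℝ}
    (hB : ∀ u ∈ Set.Icc (0 : ℝ) 1, ∀ v ∈ Set.Icc (0 : ℝ) 1,
      gibbsCov (fun ω => H ω + u * F ω + v * G ω) G F ≤ B) :
    logPartition (H + F + G) - logPartition (H + F) - (logPartition (H + G) - logPartition H) ≤
      B := by
  have hmean : ∀ v ∈ Set.Icc (0 : ℝ) 1, gibbsMean (fun ω => (H + F) ω + v * G ω) G -
      gibbsMean (fun ω => H ω + v * G ω) G ≤ B := fun v hv => by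
    have hmvt := sub_le_of_hasDerivAt_le
      (hasDerivAt_gibbsMean (fun ω => H ω + v * G ω) F G) fun u hu => by
        simpa only [add_right_comm] using hB u hu v hv
    simpa only [one_mul, zero_mul, add_zero, add_right_comm, Pi.add_apply] using hmvt
  have hmvt := sub_le_of_hasDerivAt_le (fun v => (hasDerivAt_log_sum_exp (H + F) G v).sub
    (hasDerivAt_log_sum_exp H G v)) hmean
  simp only [Pi.sub_apply, one_mul, zero_mul, add_zero] at hmvt
  simp only [logPartition, Pi.add_apply] at hmvt ⊢
  linarith

theorem sum_gibbsProb_mul_div_le [Nonempty Ω] {H F G : Ω → ℝ} {B : ℝ}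
    (hB : ∀ u ∈ Set.Icc (0 : ℝ) 1, ∀ v ∈ Set.Icc (0 : ℝ) 1,
      gibbsCov (fun ω => H ω + u * F ω + v * G ω) G F ≤ B) :
    ∑ ω, gibbsProb (H + F) ω * gibbsProb (H + G) ω / gibbsProb H ω ≤ Real.exp B := by
  rw [sum_gibbsProb_mul_div]
  exact Real.exp_le_exp.2 (logPartition_mixed_le hB)

theorem sum_sub_sum_le_sqrt {p q : Ω → ℝ} (hp : ∀ ω, 0 < p ω) (hp1 : ∑ ω, p ω = 1)
    (hq1 : ∑ ω, q ω = 1) (S : Finset Ω) :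
    ∑ ω ∈ S, p ω - ∑ ω ∈ S, q ω ≤ √(∑ ω, q ω ^ 2 / p ω - 1) := by
  have hchi : ∑ ω, (p ω - q ω) ^ 2 / p ω = ∑ ω, q ω ^ 2 / p ω - 1 := by
    have hterm : ∀ ω, (p ω - q ω) ^ 2 / p ω = p ω - 2 * q ω + q ω ^ 2 / p ω := fun ω => by
      have := (hp ω).ne'
      field_simp
      ring
    simp only [hterm, Finset.sum_add_distrib, Finset.sum_sub_distrib, ← Finset.mul_sum, hp1, hq1]
    ring
  rw [← Finset.sum_sub_distrib, ← hchi]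
  refine Real.le_sqrt_of_sq_le ?_
  calc (∑ ω ∈ S, (p ω - q ω)) ^ 2 ≤ (∑ ω ∈ S, p ω) * ∑ ω ∈ S, (p ω - q ω) ^ 2 / p ω :=
        Finset.sum_sq_le_sum_mul_sum_of_sq_le_mul S (fun ω _ => (hp ω).le)
          (fun ω _ => div_nonneg (sq_nonneg _) (hp ω).le)
          fun ω _ => (mul_div_cancel₀ _ (hp ω).ne').ge
    _ ≤ (∑ ω, p ω) * ∑ ω, (p ω - q ω) ^ 2 / p ω := by
        have hp0 : ∀ ω, 0 ≤ p ω := fun ω => (hp ω).le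
        have hquot : ∀ ω, 0 ≤ (p ω - q ω) ^ 2 / p ω := fun ω => div_nonneg (sq_nonneg _) (hp0 ω)
        exact mul_le_mul (Finset.sum_le_univ_sum_of_nonneg hp0)
          (Finset.sum_le_univ_sum_of_nonneg hquot) (Finset.sum_nonneg fun ω _ => hquot ω)
          (Finset.sum_nonneg fun ω _ => hp0 ω)
    _ = _ := by rw [hp1, one_mul]

theorem exists_sum_sub_sum_le_sqrt [Nonempty ι] {p : Ω → ℝ} {q : ι → Ω → ℝ} {Q : ℝ}
    (hp : ∀ ω, 0 < p ω) (hp1 : ∑ ω, p ω = 1) (hq1 : ∀ f, ∑ ω, q f ω = 1)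
    (hQ : ∑ f, ∑ g, ∑ ω, q f ω * q g ω / p ω ≤ (Fintype.card ι : ℝ) ^ 2 * (1 + Q))
    (S : Finset Ω) : ∃ f, ∑ ω ∈ S, p ω - ∑ ω ∈ S, q f ω ≤ √Q := by
  set N : ℝ := (Fintype.card ι : ℝ)
  have hN : 0 < N := Nat.cast_pos.2 Fintype.card_pos
  set mix : Ω → ℝ := fun ω => N⁻¹ * ∑ f, q f ω
  have hmix : ∀ S : Finset Ω, ∑ ω ∈ S, mix ω = N⁻¹ * ∑ f, ∑ ω ∈ S, q f ω := fun S => by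
    rw [← Finset.mul_sum, Finset.sum_comm]
  have hmix1 : ∑ ω, mix ω = 1 := by
    simp only [hmix, hq1, Finset.sum_const, Finset.card_univ, nsmul_eq_mul, mul_one]
    exact inv_mul_cancel₀ hN.ne'
  have hsq : ∑ ω, mix ω ^ 2 / p ω - 1 ≤ Q := by
    have hterm : ∀ ω, mix ω ^ 2 / p ω = (N ^ 2)⁻¹ * ∑ f, ∑ g, q f ω * q g ω / p ω := fun ω => by
      simp only [mix, mul_pow, sq (∑ f, q f ω), Finset.sum_mul_sum, inv_pow, ← Finset.sum_div]
      exact mul_div_assoc _ _ _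
    simp only [hterm, ← Finset.mul_sum]
    rw [Finset.sum_comm, Finset.sum_congr rfl fun f _ => Finset.sum_comm, sub_le_iff_le_add',
      inv_mul_le_iff₀ (pow_pos hN 2)]
    exact hQ
  have hbound := (sum_sub_sum_le_sqrt hp hp1 hmix1 S).trans (Real.sqrt_le_sqrt hsq)
  rw [hmix, sub_le_iff_le_add', ← sub_le_iff_le_add, le_inv_mul_iff₀ hN] at hbound
  obtain ⟨f, -, hf⟩ := Finset.exists_le_of_sum_le (s := Finset.univ)
    (f := fun _ : ι => ∑ ω ∈ S, p ω - √Q) (g := fun f => ∑ ω ∈ S, q f ω)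
    Finset.univ_nonempty (by rwa [Finset.sum_const, Finset.card_univ, nsmul_eq_mul])
  exact ⟨f, by linarith⟩

end Likelihood

/-! ### A lower bound for the risk -/

section LowerBound

variable {n : ℕ}

theorem exists_gibbsCov_weightedDeg_le {θ β₀ : ℝ} (hθ : 0 ≤ θ) (h : θ < 1 / 2 ∨ β₀ ≠ 0) :
    ∃ K δ : ℝ, 0 ≤ K ∧ 0 < δ ∧ ∀ n : ℕ, 2 ≤ n → ∀ β : Fin n → ℝ,
      (∀ i, β i ∈ Set.Icc β₀ (β₀ + δ)) → ∀ u v : Fin n → ℝ, 0 ≤ u → 0 ≤ v →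
        gibbsCov (energy θ β) (weightedDeg u) (weightedDeg v) ≤
          4 * K * (n * ∑ i, u i * v i + (∑ i, u i) * ∑ i, v i) := by
  rcases lt_trichotomy β₀ 0 with hneg | rfl | hpos
  · have hr : 0 < -β₀ / 2 := by linarith
    refine ⟨1 / (-β₀ / 2), -β₀ / 2, by positivity, hr, fun n hn β hβ u v hu hv => ?_⟩
    rw [← gibbsCov_energy_neg]
    refine (gibbsCov_weightedDeg_anti hθ (by omega) (ρ := fun _ => -β₀ / 2) (fun _ => hr.le)
      (fun i => ?_) hu hv).trans (gibbsCov_weightedDeg_le hθ hn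
        (gibbsCov_totalSpin_le_of_pos hθ (by omega) hr) (by positivity) hu hv)
    have := (hβ i).2
    simp only [Pi.neg_apply]
    linarith
  · have hθ' : θ < 1 / 2 := h.resolve_right fun h0 => h0 rfl
    have hK : 0 ≤ 1 / (2 * (1 - 2 * θ)) := div_nonneg zero_le_one (by linarith)
    exact ⟨1 / (2 * (1 - 2 * θ)), 1, hK, one_pos, fun n hn β hβ u v hu hv =>
      (gibbsCov_weightedDeg_anti hθ (by omega) (ρ := fun _ => 0) (fun _ => le_rfl)
        (fun i => (hβ i).1) hu hv).trans (gibbsCov_weightedDeg_le hθ hn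
          (gibbsCov_totalSpin_le hθ hθ' hn _) hK hu hv)⟩
  · exact ⟨1 / β₀, 1, by positivity, one_pos, fun n hn β hβ u v hu hv =>
      (gibbsCov_weightedDeg_anti hθ (by omega) (ρ := fun _ => β₀) (fun _ => hpos.le)
        (fun i => (hβ i).1) hu hv).trans (gibbsCov_weightedDeg_le hθ hn
          (gibbsCov_totalSpin_le_of_pos hθ (by omega) hpos) (by positivity) hu hv)⟩

theorem pmf_eq_gibbsProb (θ : ℝ) (β : Fin n → ℝ) : pmf θ β = gibbsProb (energy θ β) :=
  funext fun Y => (pmf_eq θ β Y).trans (gibbsProb_eq_div _ Y).symm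

open Classical in
theorem prob_eq_sum_pmf (θ : ℝ) (β : Fin n → ℝ) (S : Set (Config n)) :
    prob θ β S = ∑ Y with Y ∈ S, pmf θ β Y := (Finset.sum_filter _ _).symm

theorem prob_eq_one_add_prob_eq_zero (θ : ℝ) (β : Fin n → ℝ) (T : Test n) :
    prob θ β {Y | T Y = 1} + prob θ β {Y | T Y = 0} = 1 := by
  rw [← sum_gibbsProb (energy θ β), ← pmf_eq_gibbsProb, prob, prob, ← Finset.sum_add_distrib]
  refine Finset.sum_congr rfl fun Y _ => ?_
  rcases Fin.exists_fin_two.1 ⟨T Y, rfl⟩ with h | h <;> simp [h]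

theorem sum_pmf_mul_div_le {θ B : ℝ} {β μ ν : Fin n → ℝ}
    (hB : ∀ u ∈ Set.Icc (0 : ℝ) 1, ∀ v ∈ Set.Icc (0 : ℝ) 1,
      gibbsCov (energy θ fun i => β i + u * μ i + v * ν i) (weightedDeg ν) (weightedDeg μ) ≤
        4 * B) :
    ∑ Y, pmf θ (fun i => β i + μ i) Y * pmf θ (fun i => β i + ν i) Y / pmf θ β Y ≤
      Real.exp B := by
  have henergy : ∀ w : Fin n → ℝ, energy θ (fun i => β i + w i) =
      energy θ β + weightedDeg fun i => 1 / 2 * w i := fun w => by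
    have hadd := energy_add_mul θ β w 1
    simp only [one_mul] at hadd
    exact hadd
  simp only [pmf_eq_gibbsProb, henergy]
  refine sum_gibbsProb_mul_div_le fun u hu v hv => ?_
  have := hB u hu v hv
  simp only [energy_add_mul, weightedDeg_const_mul, gibbsCov_const_mul_left,
    gibbsCov_const_mul_right] at this ⊢
  linarith

theorem one_sub_sqrt_le_risk {ι : Type*} [Fintype ι] [Nonempty ι] {θ β₀ s A Q : ℝ}
    {μ : ι → Fin n → ℝ} {D : ι → ι → ℝ}
    (hμ : ∀ f, (fun i => β₀ + μ f i) ∈ alternatives n β₀ s A)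
    (hD : ∀ f g, ∀ u ∈ Set.Icc (0 : ℝ) 1, ∀ v ∈ Set.Icc (0 : ℝ) 1,
      gibbsCov (energy θ fun i => β₀ + u * μ f i + v * μ g i)
        (weightedDeg (μ g)) (weightedDeg (μ f)) ≤ 4 * D f g)
    (hQ : ∑ f, ∑ g, Real.exp (D f g) ≤ (Fintype.card ι : ℝ) ^ 2 * (1 + Q)) (T : Test n) :
    1 - √Q ≤ risk θ β₀ s A T := by
  classical
  obtain ⟨f, hf⟩ := exists_sum_sub_sum_le_sqrt (p := pmf θ fun _ => β₀)
    (q := fun f => pmf θ fun i => β₀ + μ f i)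
    (fun Y => by rw [pmf_eq_gibbsProb]; exact gibbsProb_pos _ Y)
    (by rw [pmf_eq_gibbsProb, sum_gibbsProb])
    (fun f => by rw [pmf_eq_gibbsProb, sum_gibbsProb])
    ((Finset.sum_le_sum fun f _ => Finset.sum_le_sum fun g _ => sum_pmf_mul_div_le (hD f g)).trans
      hQ) {Y | T Y = 0}
  have hsup : prob θ (fun i => β₀ + μ f i) {Y | T Y = 0} ≤
      ⨆ β : alternatives n β₀ s A, prob θ β.1 {Y | T Y = 0} :=
    le_ciSup (f := fun β : alternatives n β₀ s A => prob θ β.1 {Y | T Y = 0})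
      ⟨1, by rintro _ ⟨β, rfl⟩; exact prob_le_one _ _ _⟩ ⟨_, hμ f⟩
  have hsum := prob_eq_one_add_prob_eq_zero θ (fun _ => β₀) T
  have hprob : ∀ β : Fin n → ℝ, prob θ β {Y | T Y = 0} = ∑ Y with T Y = 0, pmf θ β Y :=
    fun β => by rw [prob_eq_sum_pmf]; simp only [Set.mem_ofPred_eq]
  rw [← hprob, ← hprob] at hf
  rw [risk]
  linarith

end LowerBound

/-! ### The block prior -/

section BlockPrior

variable {α κ V : Type*} [Fintype α]

/-- The choice of one point in each of the disjoint blocks `φ (a, ·)`, prescribed by `f`. The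
uniform choice is the prior on the supports of the signals in the lower bound. -/
def transversal (φ : α × κ ↪ V) (f : α → κ) : Finset V :=
  Finset.univ.map ⟨fun a => φ (a, f a), fun _ _ h => congrArg Prod.fst (φ.injective h)⟩

theorem card_transversal (φ : α × κ ↪ V) (f : α → κ) :
    (transversal φ f).card = Fintype.card α := Finset.card_map _

theorem card_transversal_inter [DecidableEq V] [DecidableEq κ] (φ : α × κ ↪ V) (f g : α → κ) :
    (transversal φ f ∩ transversal φ g).card = Finset.card {a | f a = g a} := by
  rw [← Finset.card_map ⟨fun a => φ (a, f a), fun _ _ h => congrArg Prod.fst (φ.injective h)⟩]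
  congr 1
  ext i
  simp only [transversal, Finset.mem_inter, Finset.mem_map, Finset.mem_filter, Finset.mem_univ,
    true_and]
  constructor
  · rintro ⟨⟨a, rfl⟩, b, hb⟩
    obtain ⟨rfl, hab⟩ := Prod.ext_iff.1 (φ.injective hb)
    exact ⟨_, hab.symm, rfl⟩
  · rintro ⟨a, ha, rfl⟩
    exact ⟨⟨a, rfl⟩, a, congrArg (fun v => φ (a, v)) ha.symm⟩

theorem sum_exp_mul_card_agree [DecidableEq α] [Fintype κ] [DecidableEq κ] (x : ℝ) (f : α → κ) :
    ∑ g : α → κ, Real.exp (x * Finset.card {a | f a = g a}) =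
      (Fintype.card κ + (Real.exp x - 1)) ^ Fintype.card α := by
  have hprod : ∀ g : α → κ, Real.exp (x * Finset.card {a | f a = g a}) =
      ∏ a, if f a = g a then Real.exp x else 1 := fun g => by
    rw [Finset.prod_ite, Finset.prod_const, Finset.prod_const_one, mul_one, mul_comm,
      Real.exp_nat_mul]
  have hsum : ∀ a, ∑ v, (if f a = v then Real.exp x else 1) =
      Fintype.card κ + (Real.exp x - 1) := fun a => by
    have hterm : ∀ v, (if f a = v then Real.exp x else 1) =
        1 + if f a = v then Real.exp x - 1 else 0 := fun v => by split_ifs <;> ring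
    simp only [hterm, Finset.sum_add_distrib, Finset.sum_ite_eq, Finset.mem_univ, if_true,
      Finset.sum_const, Finset.card_univ, nsmul_eq_mul, mul_one]
  simp only [hprod]
  rw [← Fintype.prod_sum fun a v => if f a = v then Real.exp x else 1]
  simp only [hsum, Finset.prod_const, Finset.card_univ]

theorem add_pow_le_pow_mul_exp {m y : ℝ} (hm : 0 < m) (hy : 0 ≤ y) (s : ℕ) :
    (m + y) ^ s ≤ m ^ s * Real.exp (s * y / m) :=
  calc (m + y) ^ s = m ^ s * (y / m + 1) ^ s := by
        rw [← mul_pow, mul_add, mul_div_cancel₀ y hm.ne', mul_one, add_comm]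
    _ ≤ m ^ s * Real.exp (y / m) ^ s := by
        gcongr
        exact Real.add_one_le_exp _
    _ = m ^ s * Real.exp (s * y / m) := by rw [← Real.exp_nat_mul, mul_div_assoc]

variable {n : ℕ}

/-- The signal of strength `A` supported on `U`. -/
def signalOn (A : ℝ) (U : Finset (Fin n)) (i : Fin n) : ℝ := if i ∈ U then A else 0

theorem signalOn_mem_Icc {A : ℝ} (hA : 0 ≤ A) (U : Finset (Fin n)) (i : Fin n) :
    signalOn A U i ∈ Set.Icc 0 A := by
  rw [signalOn]
  split_ifs
  · exact ⟨hA, le_rfl⟩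
  · exact ⟨le_rfl, hA⟩

theorem sum_signalOn (A : ℝ) (U : Finset (Fin n)) : ∑ i, signalOn A U i = U.card * A := by
  simp only [signalOn, Finset.sum_ite_mem, Finset.univ_inter, Finset.sum_const, nsmul_eq_mul]

theorem sum_signalOn_mul_signalOn (A : ℝ) (U W : Finset (Fin n)) :
    ∑ i, signalOn A U i * signalOn A W i = (U ∩ W).card * A ^ 2 := by
  simp only [signalOn, ite_zero_mul_ite_zero, ← Finset.mem_inter, Finset.sum_ite_mem,
    Finset.univ_inter, Finset.sum_const, nsmul_eq_mul, sq]

theorem add_signalOn_mem_alternatives {A s : ℝ} (β₀ : ℝ) (hA : A ≠ 0) {U : Finset (Fin n)}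
    (hs : s ≤ U.card) : (fun i => β₀ + signalOn A U i) ∈ alternatives n β₀ s A := by
  have hsupp : Function.support (signalOn A U) = U := by
    ext i
    simp [signalOn, hA]
  refine ⟨signalOn A U, fun _ => rfl, ?_, fun i hi => ?_⟩
  · rwa [hsupp, Set.ncard_coe_finset]
  · rw [hsupp] at hi
    exact (if_pos hi).ge

section CovarianceBound

variable {θ β₀ K δ A σ : ℝ} (hK0 : 0 ≤ K) (hA : 0 < A) (hAδ : 2 * A ≤ δ)
  (hK : ∀ β : Fin n → ℝ, (∀ i, β i ∈ Set.Icc β₀ (β₀ + δ)) → ∀ u v : Fin n → ℝ, 0 ≤ u → 0 ≤ v →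
    gibbsCov (energy θ β) (weightedDeg u) (weightedDeg v) ≤
      4 * K * (n * ∑ i, u i * v i + (∑ i, u i) * ∑ i, v i))
include hK0 hA hAδ hK

theorem one_sub_sqrt_exp_le_risk {s m : ℕ} (hm : 0 < m) (hsm : s * m ≤ n) (hσ : σ ≤ s)
    (T : Test n) :
    1 - √(Real.exp (K * (s * A) ^ 2 + s * (Real.exp (K * (n * A ^ 2)) - 1) / m) - 1) ≤
      risk θ β₀ σ A T := by
  have : Nonempty (Fin m) := ⟨⟨0, hm⟩⟩
  set φ : Fin s × Fin m ↪ Fin n := finProdFinEquiv.toEmbedding.trans (Fin.castLEEmb hsm)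
  have hcard : ∀ f, (transversal φ f).card = s := fun f => by
    rw [card_transversal, Fintype.card_fin]
  have hmem := fun f => signalOn_mem_Icc hA.le (transversal φ f)
  have hx : 0 ≤ K * (n * A ^ 2) := by positivity
  refine one_sub_sqrt_le_risk (μ := fun f => signalOn A (transversal φ f))
    (D := fun f g => K * (s * A) ^ 2 + K * (n * A ^ 2) * Finset.card {a | f a = g a})
    (fun f => add_signalOn_mem_alternatives β₀ hA.ne' (by rwa [hcard]))
    (fun f g u hu v hv => ?_) ?_ T
  · refine (hK _ (fun i => ⟨?_, ?_⟩) _ _ (fun i => (hmem g i).1) fun i => (hmem f i).1).trans_eq ?_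
    · linarith [mul_nonneg hu.1 (hmem f i).1, mul_nonneg hv.1 (hmem g i).1]
    · linarith [mul_le_of_le_one_left (hmem f i).1 hu.2, mul_le_of_le_one_left (hmem g i).1 hv.2,
        (hmem f i).2, (hmem g i).2]
    · rw [sum_signalOn_mul_signalOn, sum_signalOn, sum_signalOn, Finset.inter_comm,
        card_transversal_inter, hcard, hcard]
      ring
  · have hexp := add_pow_le_pow_mul_exp (Nat.cast_pos.2 hm)
      (sub_nonneg.2 (Real.one_le_exp hx)) s
    simp only [Real.exp_add, ← Finset.mul_sum, sum_exp_mul_card_agree, Finset.sum_const,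
      Finset.card_univ, Fintype.card_fun, Fintype.card_fin, nsmul_eq_mul, Nat.cast_pow,
      add_sub_cancel]
    calc Real.exp (K * (s * A) ^ 2) * (m ^ s * (m + (Real.exp (K * (n * A ^ 2)) - 1)) ^ s)
        ≤ Real.exp (K * (s * A) ^ 2) * (m ^ s *
            (m ^ s * Real.exp (s * (Real.exp (K * (n * A ^ 2)) - 1) / m))) := by gcongr
      _ = (m ^ s) ^ 2 * (Real.exp (K * (s * A) ^ 2) *
            Real.exp (s * (Real.exp (K * (n * A ^ 2)) - 1) / m)) := by ring

theorem one_sub_sqrt_exp_sq_le_risk (hσ1 : 1 ≤ σ) (hσn : σ ≤ n) (hnA : n * A ^ 2 ≤ 1)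
    (T : Test n) :
    1 - √(Real.exp ((K + 2 * K * Real.exp K) * (2 * (σ * A)) ^ 2) - 1) ≤ risk θ β₀ σ A T := by
  set s := ⌈σ⌉₊
  set m := n / s
  have hσs : σ ≤ s := Nat.le_ceil σ
  have hsσ : (s : ℝ) ≤ 2 * σ := by linarith [Nat.ceil_lt_add_one (zero_le_one.trans hσ1)]
  have hs : 0 < s := Nat.ceil_pos.2 (by linarith)
  have hm : 0 < m := Nat.div_pos (Nat.ceil_le.2 hσn) hs
  have hm0 : (0 : ℝ) < m := Nat.cast_pos.2 hm
  have hn : (n : ℝ) ≤ 2 * (s * m) := by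
    have hlt : n < s * (m + 1) := Nat.lt_mul_div_succ n hs
    have hle : s ≤ s * m := Nat.le_mul_of_pos_right s hm
    exact_mod_cast (by linarith : n ≤ 2 * (s * m))
  have hexp : Real.exp (K * (n * A ^ 2)) - 1 ≤ K * (n * A ^ 2) * Real.exp K := by
    have hx0 : 0 ≤ K * (n * A ^ 2) := by positivity
    have hbound := (le_abs_self _).trans (abs_exp_sub_one_le_mul_exp (K * (n * A ^ 2)))
    rw [abs_of_nonneg hx0] at hbound
    refine hbound.trans (mul_le_mul_of_nonneg_left (Real.exp_le_exp.2 ?_) hx0)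
    exact mul_le_of_le_one_right hK0 hnA
  have hagree : s * (Real.exp (K * (n * A ^ 2)) - 1) / m ≤ 2 * K * Real.exp K * (s * A) ^ 2 := by
    rw [div_le_iff₀ hm0]
    calc s * (Real.exp (K * (n * A ^ 2)) - 1) ≤ s * (K * (n * A ^ 2) * Real.exp K) := by gcongr
      _ = s * (K * A ^ 2 * Real.exp K) * n := by ring
      _ ≤ s * (K * A ^ 2 * Real.exp K) * (2 * (s * m)) := by gcongr
      _ = _ := by ring
  refine le_trans ?_ (one_sub_sqrt_exp_le_risk hK0 hA hAδ hK hm (Nat.mul_div_le n s) hσs T)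
  gcongr
  calc K * (s * A) ^ 2 + s * (Real.exp (K * (n * A ^ 2)) - 1) / m
      ≤ (K + 2 * K * Real.exp K) * (s * A) ^ 2 := by linarith
    _ ≤ (K + 2 * K * Real.exp K) * (2 * (σ * A)) ^ 2 := by
        rw [← mul_assoc 2 σ A]
        gcongr

end CovarianceBound

end BlockPrior

/-! ### Asymptotics -/

section Asymptotics

theorem risk_le_two {n : ℕ} (θ β₀ s A : ℝ) (T : Test n) : risk θ β₀ s A T ≤ 2 := by
  have := risk_le (s := s) (A := A) zero_le_one (prob_le_one θ (fun _ => β₀) {Y | T Y = 1})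
    fun β _ => prob_le_one θ β {Y | T Y = 0}
  linarith

theorem allTestsAsympPowerless_of_le {θ β₀ : ℝ} {s A ε : ℕ → ℝ} (hε : Tendsto ε atTop (𝓝 0))
    (h : ∀ᶠ n in atTop, ∀ T : Test n, 1 - ε n ≤ risk θ β₀ (s n) (A n) T) :
    AllTestsAsympPowerless θ β₀ s A := by
  have hle : ∀ T : ∀ n, Test n, IsBoundedUnder (· ≤ ·) atTop
      fun n => risk θ β₀ (s n) (A n) (T n) := fun T =>
    isBoundedUnder_of ⟨2, fun n => risk_le_two _ _ _ _ _⟩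
  have hge : ∀ T : ∀ n, Test n, IsBoundedUnder (· ≥ ·) atTop
      fun n => risk θ β₀ (s n) (A n) (T n) := fun T =>
    isBoundedUnder_of ⟨0, fun n => risk_nonneg _ _ _ _ _⟩
  have hlim : Tendsto (fun n => 1 - ε n) atTop (𝓝 1) := by simpa using hε.const_sub 1
  have hliminf : ∀ T : ∀ n, Test n,
      1 ≤ liminf (fun n => risk θ β₀ (s n) (A n) (T n)) atTop := fun T => by
    rw [← hlim.liminf_eq]
    exact liminf_le_liminf (h.mono fun n hn => hn (T n)) hlim.isBoundedUnder_ge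
      (hle T).isCoboundedUnder_ge
  exact ⟨hliminf, fun T hT => tendsto_of_le_liminf_of_limsup_le (hliminf T) hT (hle T) (hge T)⟩

theorem allTestsAsympPowerless {θ β₀ : ℝ} (hθ : 0 ≤ θ) (h : θ < 1 / 2 ∨ β₀ ≠ 0) {s A : ℕ → ℝ}
    (hs : ∀ᶠ n : ℕ in atTop, 1 ≤ s n ∧ s n ≤ n)
    (hA : ∀ᶠ n : ℕ in atTop, 0 < A n ∧ n * A n ^ 2 ≤ 1)
    (hsA : Tendsto (fun n => s n * A n) atTop (𝓝 0)) : AllTestsAsympPowerless θ β₀ s A := by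
  obtain ⟨K, δ, hK0, hδ, hK⟩ := exists_gibbsCov_weightedDeg_le hθ h
  have hlim : Tendsto (fun n => √(Real.exp ((K + 2 * K * Real.exp K) * (2 * (s n * A n)) ^ 2) - 1))
      atTop (𝓝 0) := by
    have hcont : Continuous fun x : ℝ =>
        √(Real.exp ((K + 2 * K * Real.exp K) * (2 * x) ^ 2) - 1) := by fun_prop
    simpa [Function.comp_def] using (hcont.tendsto 0).comp hsA
  refine allTestsAsympPowerless_of_le hlim ?_
  filter_upwards [eventually_ge_atTop 2, hs, hA, hsA.eventually_le_const (half_pos hδ)]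
    with n hn ⟨hs1, hsn⟩ ⟨hA0, hnA⟩ hδA T
  have hAδ : 2 * A n ≤ δ := by linarith [le_mul_of_one_le_left hA0.le hs1]
  exact one_sub_sqrt_exp_sq_le_risk hK0 hA0 hAδ (hK n hn) hs1 hsn hnA T

theorem tendsto_natCast_rpow_neg {p : ℝ} (hp : p < 0) :
    Tendsto (fun n : ℕ => (n : ℝ) ^ p) atTop (𝓝 0) := by
  simpa [Function.comp_def] using
    (tendsto_rpow_neg_atTop (neg_pos.2 hp)).comp (tendsto_natCast_atTop_atTop (R := ℝ))

theorem allTestsAsympPowerless_rpow {θ β₀ b t : ℝ} (hθ : 0 ≤ θ) (h : θ < 1 / 2 ∨ β₀ ≠ 0)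
    (hb : 0 ≤ b) (hb1 : b ≤ 1) (ht : t + 1 / 2 ≤ 0) (hbt : b + t < 0) :
    AllTestsAsympPowerless θ β₀ (fun n => (n : ℝ) ^ b) (fun n => (n : ℝ) ^ t) := by
  refine allTestsAsympPowerless hθ h ?_ ?_ ((tendsto_natCast_rpow_neg hbt).congr' ?_) <;>
    filter_upwards [eventually_ge_atTop 1] with n hn
  all_goals
    have hn1 : (1 : ℝ) ≤ n := Nat.one_le_cast.2 hn
    have hn0 : (0 : ℝ) < n := one_pos.trans_le hn1
  · exact ⟨Real.one_le_rpow hn1 hb, by simpa using Real.rpow_le_rpow_of_exponent_le hn1 hb1⟩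
  · refine ⟨Real.rpow_pos_of_pos hn0 t, ?_⟩
    have hpow : (n : ℝ) * ((n : ℝ) ^ t) ^ 2 = (n : ℝ) ^ (1 + t * 2) := by
      rw [Real.rpow_add hn0, Real.rpow_one, Real.rpow_mul hn0.le, Real.rpow_two]
    rw [hpow]
    exact Real.rpow_le_one_of_one_le_of_nonpos hn1 (by linarith)
  · exact Real.rpow_add hn0 b t

theorem rpow_pos_and_le_one_eventually {t : ℝ} (ht : t ≤ 0) :
    ∀ᶠ n : ℕ in atTop, 0 < (n : ℝ) ^ t ∧ (n : ℝ) ^ t ≤ 1 := by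
  filter_upwards [eventually_ge_atTop 1] with n hn
  have hn1 : (1 : ℝ) ≤ n := Nat.one_le_cast.2 hn
  exact ⟨Real.rpow_pos_of_pos (one_pos.trans_le hn1) t,
    Real.rpow_le_one_of_one_le_of_nonpos hn1 ht⟩

theorem tendsto_sqrt_mul_log_div_rpow {t : ℝ} (ht : 0 < t + 1 / 2) :
    Tendsto (fun n : ℕ => √(n * Real.log n) / ((n : ℝ) * (n : ℝ) ^ t)) atTop (𝓝 0) := by
  have hlog : Tendsto (fun n : ℕ => √(Real.log n / (n : ℝ) ^ (1 + t * 2))) atTop (𝓝 0) := by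
    have := ((isLittleO_log_rpow_atTop (by linarith : 0 < 1 + t * 2)).tendsto_div_nhds_zero.comp
      tendsto_natCast_atTop_atTop).sqrt
    simpa only [Real.sqrt_zero, Function.comp_apply] using this
  refine hlog.congr' ?_
  filter_upwards [eventually_ge_atTop 1] with n hn
  have hn0 : (0 : ℝ) < n := Nat.cast_pos.2 hn
  rw [← Real.sqrt_sq (by positivity : 0 ≤ (n : ℝ) * (n : ℝ) ^ t), ← Real.sqrt_div' _ (sq_nonneg _),
    Real.rpow_add hn0, Real.rpow_one, Real.rpow_mul hn0.le, Real.rpow_two]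
  congr 1
  field_simp

end Asymptotics

theorem nonneg_and_of_mem_Theta1 {θ β₀ : ℝ} (hΘ : (θ, β₀) ∈ Theta1) :
    0 ≤ θ ∧ (θ < 1 / 2 ∨ β₀ ≠ 0) := by
  rcases hΘ with ⟨hθ, -⟩ | ⟨hθ, hβ₀⟩
  · exact ⟨hθ.1.le, .inl hθ.2⟩
  · exact ⟨hθ.le, .inr hβ₀⟩

end TwoStar

end

open TwoStar in
theorem theorem3_general {θ : ℝ} (hθ : 0 ≤ θ) :
    ∃ C : ℝ, 0 < C ∧ ∀ β₀ b t : ℝ, t ≤ 0 →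
      ((θ < 1 / 2 ∨ β₀ ≠ 0) → 0 ≤ b → b ≤ 1 → t + 1 / 2 ≤ 0 → b + t < 0 →
        AllTestsAsympPowerless θ β₀ (fun n => (n : ℝ) ^ b) (fun n => (n : ℝ) ^ t)) ∧
      (∀ L : ℕ → ℝ, Tendsto (fun n : ℕ => L n / (n : ℝ)) atTop atTop →
        Tendsto (fun n : ℕ => L n / ((n : ℝ) * (n : ℝ) ^ b * (n : ℝ) ^ t)) atTop (𝓝 0) →
        AsympPowerful θ β₀ (fun n => (n : ℝ) ^ b) (fun n => (n : ℝ) ^ t)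
          (fun n => sumTest n θ β₀ (L n))) ∧
      (0 < t + 1 / 2 →
        AsympPowerful θ β₀ (fun n => (n : ℝ) ^ b) (fun n => (n : ℝ) ^ t)
          (fun n => maxTest n θ β₀ (C * √((n : ℝ) * Real.log n)))) := by
  have hC : 0 < varProxy θ / 2 + 2 := by linarith [varProxy_nonneg hθ]
  refine ⟨varProxy θ / 2 + 2, hC, fun β₀ b t ht => ?_⟩
  have hs : ∀ᶠ n : ℕ in atTop, 0 < (n : ℝ) ^ b :=
    (eventually_gt_atTop 0).mono fun n hn => Real.rpow_pos_of_pos (Nat.cast_pos.2 hn) b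
  have hA := rpow_pos_and_le_one_eventually ht
  exact ⟨fun h hb hb1 ht2 hbt => allTestsAsympPowerless_rpow hθ h hb hb1 ht2 hbt,
    fun L hL hL' => asympPowerful_sumTest hθ β₀ hs hA hL hL',
    fun ht2 => asympPowerful_maxTest hθ β₀ hs hA (tendsto_sqrt_mul_log_div_rpow ht2)⟩

open TwoStar in
theorem theorem3 (θ β₀ : ℝ) (hΘ : (θ, β₀) ∈ Theta1) :
    ∃ C : ℝ, 0 < C ∧ ∀ b t : ℝ, 0 < b → b < 1 → t < 0 →
      -- (a)
      (1 / 2 ≤ b → b + t < 0 →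
        AllTestsAsympPowerless θ β₀ (fun n => (n : ℝ) ^ b) (fun n => (n : ℝ) ^ t)) ∧
      -- (b)
      (1 / 2 ≤ b → 0 < b + t → ∀ L : ℕ → ℝ,
        Tendsto (fun n : ℕ => L n / (n : ℝ)) atTop atTop →
        Tendsto (fun n : ℕ => L n / ((n : ℝ) * (n : ℝ) ^ b * (n : ℝ) ^ t)) atTop (𝓝 0) →
        AsympPowerful θ β₀ (fun n => (n : ℝ) ^ b) (fun n => (n : ℝ) ^ t)
          (fun n => sumTest n θ β₀ (L n))) ∧
      -- (c)
      (b < 1 / 2 → t + 1 / 2 ≤ 0 →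
        AllTestsAsympPowerless θ β₀ (fun n => (n : ℝ) ^ b) (fun n => (n : ℝ) ^ t)) ∧
      -- (d)
      (b < 1 / 2 → 0 < t + 1 / 2 →
        AsympPowerful θ β₀ (fun n => (n : ℝ) ^ b) (fun n => (n : ℝ) ^ t)
          (fun n => maxTest n θ β₀ (C * Real.sqrt ((n : ℝ) * Real.log n)))) := by
  obtain ⟨hθ, h⟩ := nonneg_and_of_mem_Theta1 hΘ
  obtain ⟨C, hC, hgen⟩ := theorem3_general hθ
  refine ⟨C, hC, fun b t hb hb1 ht => ?_⟩
  obtain ⟨hless, hsum, hmax⟩ := hgen β₀ b t ht.le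
  exact ⟨fun hb2 hbt => hless h hb.le hb1.le (by linarith) hbt, fun _ _ => hsum,
    fun hb2 ht2 => hless h hb.le hb1.le ht2 (by linarith), fun _ => hmax⟩
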